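/- All graphs are finite, undirected and simple. For $k\in\mathbb N$, the shallow vortex grid $H_k$ of order $k$ is the graph with vertices $c^i_j$ ($1\le i\le k$, $1\le j\le 2k$) and the following edges, where lower indices are read modulo $2k$ and loops are ignored: $c^i_jc^i_{j+1}$ for all $i,j$ (so that each $c^i_1,\dots,c^i_{2k}$ forms a cycle), $c^i_jc^{i+1}_j$ for all $j$ and $1\le i<k$, and $c^1_jc^1_{j+2}$ for all $j$. For a graph $G$ put $$\mathsf p(G)=\max\{k\in\mathbb N : H_k \text{ is a minor of } G\}.$$ Given a tree decomposition $(T,\beta)$ of $G$, the torso $G_t$ of $G$ at $t\in V(T)$ is the graph obtained from $G[\beta(t)]$ by joining any two distinct vertices $x,y\in\beta(t)$ for which some neighbour $d$ of $t$ in $T$ satisfies $\{x,y\}\subseteq\beta(d)$. Let $\mathsf p_{\text{-ga}}(G)$ be the minimum $k\in\mathbb N$ such that $G$ has a tree decomposition $(T,\beta)$ in which for every $t\in V(T)$ with $|V(G_t)|>k$ there is a set $A\subseteq V(G_t)$ with $|A|\le k$ such that $G_t-A$ can be embedded in a surface of Euler genus at most $k$. Then $\mathsf p\preceq\mathsf p_{\text{-ga}}$;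 that is, there is a function $f:\mathbb N\to\mathbb N$ such that for every graph $G$ $$\mathsf p(G)\le f\bigl(\mathsf p_{\text{-ga}}(G)\bigr).$$ -/

import Mathlib

namespace VortexGrid

/-! ### Minors and shallow vortex grids -/

/-- `H` is a minor of `G`: there is a minor model, that is, a family of pairwise disjoint connected
(in particular non-empty) branch sets `X w` in `G`, one for every vertex `w` of `H`, such that for
every edge of `H` there is an edge of `G` between the corresponding branch sets. -/
def IsMinor {W V : Type*} (H : SimpleGraph W) (G : SimpleGraph V) : Prop :=
  ∃ X : W → Set V,
    (∀ w, (G.induce (X w)).Connected) ∧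
    (∀ w w', w ≠ w' → Disjoint (X w) (X w')) ∧
    (∀ w w', H.Adj w w' → ∃ x ∈ X w, ∃ y ∈ X w', G.Adj x y)

/-- The shallow vortex grid `H_k` of order `k`. The vertex `(i, j)` is the `j`-th vertex of the
`i`-th cycle, both counted from `0`. There are `k` concentric cycles on `2k` vertices each;
consecutive cycles are joined by the `2k` spokes; and on the first cycle every vertex is joined
to the vertex two steps further. (`SimpleGraph.fromRel` symmetrizes the relation and
discards the loops, which matters for `k = 1` only.) -/
def shallowVortexGrid (k : ℕ) : SimpleGraph (Fin k × Fin (2 * k)) :=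
  SimpleGraph.fromRel fun a b =>
    (a.1 = b.1 ∧ (b.2 : ℕ) = ((a.2 : ℕ) + 1) % (2 * k)) ∨
    ((b.1 : ℕ) = (a.1 : ℕ) + 1 ∧ a.2 = b.2) ∨
    ((a.1 : ℕ) = 0 ∧ (b.1 : ℕ) = 0 ∧ (b.2 : ℕ) = ((a.2 : ℕ) + 2) % (2 * k))

/-- The parameter `p(G) = max {k | H_k is a minor of G}`. -/
noncomputable def vortexParam {V : Type*} (G : SimpleGraph V) : ℕ :=
  sSup {k | IsMinor (shallowVortexGrid k) G}

/-- On finite graphs the maximum in the definition of `vortexParam` exists. -/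
theorem isGreatest_vortexParam {V : Type*} [Finite V] (G : SimpleGraph V) :
    IsGreatest {k | IsMinor (shallowVortexGrid k) G} (vortexParam G) := by
  have hne : ({k | IsMinor (shallowVortexGrid k) G} : Set ℕ).Nonempty :=
    ⟨0, fun w => w.1.elim0, fun w => w.1.elim0, fun w => w.1.elim0, fun w => w.1.elim0⟩
  have hbd : BddAbove {k | IsMinor (shallowVortexGrid k) G} := by
    refine ⟨Nat.card V, ?_⟩
    rintro k ⟨X, hX, hdisj, -⟩
    choose x hx using fun w => (Set.nonempty_coe_sort.1 (hX w).nonempty)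
    have hinj : Function.Injective x := by
      intro w w' h
      by_contra hne
      exact Set.disjoint_left.1 (hdisj w w' hne) (hx w) (h ▸ hx w')
    have hc := Nat.card_le_card_of_injective x hinj
    simp only [Nat.card_prod, Nat.card_fin] at hc
    nlinarith
  exact ⟨Nat.sSup_mem hne hbd, fun k hk => le_csSup hbd hk⟩

/-! ### Embeddings in surfaces and Euler genus -/

/-- A flag of `G`: an edge together with one of its two ends (equivalently a dart, the chosen end
being its first vertex) and one of its two sides (the sides of each edge are labelled by `Bool`).
-/
abbrev Flag {V : Type*} (G : SimpleGraph V) : Type _ := G.Dart × Bool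

/-- Move to the other end of the edge, staying on the same side. -/
def Flag.otherEnd {V : Type*} {G : SimpleGraph V} (x : Flag G) : Flag G := (x.1.symm, x.2)

/-- Move to the other side of the edge, staying at the same end. -/
def Flag.otherSide {V : Type*} {G : SimpleGraph V} (x : Flag G) : Flag G := (x.1, !x.2)

/-- A combinatorial (cellular) embedding of a graph in a closed surface, orientable or not, with
one component of the surface for every component of the graph.

Around a vertex, the ends of the incident edges are arranged in a cyclic order; between two
consecutive ones there is a corner. The datum is the involution `corner` that pairs each flag with
the flag on the other side of the corner it belongs to. The condition `rotation` says that by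
alternately crossing edges and corners one gets around the vertex and meets all its flags,
i.e. that the edge ends at the vertex form one cyclic order. The boundary walks of the faces are
obtained by alternately following an edge side and turning at a corner; the surface arises by
gluing an open disk to each of them. -/
structure SurfaceEmbedding {V : Type*} (G : SimpleGraph V) where
  corner : Flag G → Flag G
  corner_corner : ∀ x, corner (corner x) = x
  corner_ne : ∀ x, corner x ≠ x
  corner_vertex : ∀ x, (corner x).1.fst = x.1.fst
  rotation : ∀ x y : Flag G, x.1.fst = y.1.fst →
    Relation.EqvGen (fun a b => b = corner a ∨ b = a.otherSide) x y

/-- The faces met by at least one edge: the classes of flags under the equivalence relation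
generated by following an edge side to its other end and turning at a corner. -/
def SurfaceEmbedding.Face {V : Type*} {G : SimpleGraph V} (S : SurfaceEmbedding G) : Type _ :=
  Quot (fun a b : Flag G => b = S.corner a ∨ b = a.otherEnd)

/-- The Euler characteristic `|V| - |E| + |F|` of the surface. An isolated vertex lies on a sphere
of its own and is responsible for one face, which no edge meets. -/
noncomputable def SurfaceEmbedding.eulerChar {V : Type*} {G : SimpleGraph V}
    (S : SurfaceEmbedding G) : ℤ :=
  Nat.card V - Nat.card G.edgeSet + (Nat.card S.Face + Nat.card {v : V // ∀ w, ¬ G.Adj v w})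

/-- The total Euler genus of the surface, the sum over its components of `2 - χ` (which is `2h + c`
for a sphere with `h` handles and `c` cross-caps). It is also the Euler genus of the connected
sum of the components, the connected surface that then contains the whole graph. -/
noncomputable def SurfaceEmbedding.eulerGenus {V : Type*} {G : SimpleGraph V}
    (S : SurfaceEmbedding G) : ℤ :=
  2 * Nat.card G.ConnectedComponent - S.eulerChar

/-- The finite graph `G` can be embedded in a surface of Euler genus at most `k`. -/
def EulerGenusLE {V : Type*} (G : SimpleGraph V) (k : ℕ) : Prop :=
  ∃ S : SurfaceEmbedding G, S.eulerGenus ≤ k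

/-! ### Tree decompositions and torsos -/

/-- A tree decomposition `(T, bag)` of `G`. -/
structure TreeDecomposition {V ι : Type*} (G : SimpleGraph V) (T : SimpleGraph ι) where
  isTree : T.IsTree
  bag : ι → Set V
  exists_mem_bag : ∀ v, ∃ t, v ∈ bag t
  exists_edge_bag : ∀ u v, G.Adj u v → ∃ t, u ∈ bag t ∧ v ∈ bag t
  connected_bags : ∀ v, (T.induce {t | v ∈ bag t}).Connected

/-- The torso of `G` at `t`: the subgraph induced by the bag of `t`, in which moreover any two
distinct vertices that lie in a common bag of a neighbour of `t` are made adjacent. -/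
def TreeDecomposition.torso {V ι : Type*} {G : SimpleGraph V} {T : SimpleGraph ι}
    (D : TreeDecomposition G T) (t : ι) : SimpleGraph (D.bag t) where
  Adj x y := x ≠ y ∧
    (G.Adj x y ∨ ∃ d, T.Adj t d ∧ (x : V) ∈ D.bag d ∧ (y : V) ∈ D.bag d)
  symm := ⟨by
    rintro x y ⟨hne, h⟩
    exact ⟨hne.symm, h.imp (fun e => e.symm) fun ⟨d, hd, hx, hy⟩ => ⟨d, hd, hy, hx⟩⟩⟩
  loopless := ⟨fun _ h => h.1 rfl⟩

/-- `G` has a tree decomposition (over a finite tree) in which every torso with more than `k`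
vertices can be embedded in a surface of Euler genus at most `k` after the removal of a set `A` of
at most `k` of its vertices. -/
def HasGenusApexDecomposition {V : Type*} (G : SimpleGraph V) (k : ℕ) : Prop :=
  ∃ (n : ℕ) (T : SimpleGraph (Fin n)) (D : TreeDecomposition G T),
    ∀ t, k < Nat.card (D.bag t) →
      ∃ A : Set (D.bag t), A.ncard ≤ k ∧ EulerGenusLE ((D.torso t).induce Aᶜ) k

/-- The parameter `p_{-ga}`: the minimum `k` such that `G` has a tree decomposition in which every
torso with more than `k` vertices has Euler genus at most `k` after removing at most `k` apices. -/
noncomputable def genusApexParam {V : Type*} (G : SimpleGraph V) : ℕ :=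
  sInf {k | HasGenusApexDecomposition G k}

/-- On finite graphs the minimum in the definition of `genusApexParam` exists. -/
theorem isLeast_genusApexParam {V : Type*} [Finite V] (G : SimpleGraph V) :
    IsLeast {k | HasGenusApexDecomposition G k} (genusApexParam G) := by
  have hne : ({k | HasGenusApexDecomposition G k} : Set ℕ).Nonempty := by
    refine ⟨Nat.card V, 1, ⊥, ⟨?_, fun _ => Set.univ, fun v => ⟨0, trivial⟩,
      fun u v _ => ⟨0, trivial, trivial⟩, fun v => ?_⟩, fun t ht => ?_⟩
    · exact SimpleGraph.IsTree.of_subsingleton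
    · have : Nonempty ({t : Fin 1 | v ∈ (Set.univ : Set V)} : Set (Fin 1)) := ⟨⟨0, trivial⟩⟩
      exact SimpleGraph.IsTree.of_subsingleton.connected
    · exact absurd ht (by simp)
  exact ⟨Nat.sInf_mem hne, fun k hk => Nat.sInf_le hk⟩

end VortexGrid

/-!
A graph with a decomposition into nearly embeddable torsos cannot contain a large shallow vortex
grid, for two reasons that work together.

*Genus.* Disjoint complete graphs on five vertices add up in Euler genus, even as minors, and an
apex set of size `k` destroys at most `k` of them. So a torso of the decomposition has no `2k + 1`
disjoint `K₅` minors (`not_isMinor_copiesK5`). This is proved by linear algebra over the two-element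
field. The face boundaries of an embedding form a family of cycles in which every edge occurs at
most twice, and by Euler's formula they span a subspace of the cycle space whose codimension is at
most the Euler genus (`EulerGenusLE.sparseGenusLE`). The existence of such a family is the only
property of embeddings that is used; for codimension zero it is MacLane's planarity criterion. It is
inherited by minors (`SparseGenusLE.of_isMinor`), because a deletion replaces two vectors of the
family by their sum and a contraction forgets a coordinate. For `n` disjoint copies of `K₅` the
cycle space has dimension `6n`, while a subspace spanned by such a family has dimension at most
`5n`: for one copy since each of at least `d + 1` nonzero cycles has at least three of the ten
edges, and in general by rank-nullity (`IsTwoSparse.finrank_le_mul`). Hence the codimension is at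
least `n`.

*Tree decompositions.* Adhesion sets are cliques in a torso, so by the above they have fewer than
`10k + 5` elements. In a minor model of the shallow vortex grid, the unions of a row and a column are
connected and intersect pairwise, so that some bag meets all of them
(`TreeDecomposition.exists_bag_meets_all`). This bag then meets every connected piece of the grid
that has vertices in `10k + 5` rows (`exists_mem_bag_of_meets_rows`). Each block of six columns of
the grid contains a `K₅` minor whose branch sets meet that many rows: it exploits that two crossing
edges on the innermost cycle are not planar together with the grid around them (`branchK5`). As
traces of connected sets are connected in the torso, a grid of order more than `20k + 10` yields
`2k + 1` disjoint `K₅` minors in one torso.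
-/

namespace VortexGrid

open Module

/-! ### Two-sparse subspaces -/

/-- Rank-nullity for the restriction of a linear map to a submodule. -/
theorem finrank_map_add_finrank_inf_ker {K M N : Type*} [Field K] [AddCommGroup M] [Module K M]
    [AddCommGroup N] [Module K N] [FiniteDimensional K M] (B : Submodule K M) (r : M →ₗ[K] N) :
    finrank K (B.map r) + finrank K (B ⊓ LinearMap.ker r : Submodule K M) = finrank K B := by
  have h := LinearMap.finrank_range_add_finrank_ker (r.domRestrict B)
  have h1 : LinearMap.range (r.domRestrict B) = B.map r := LinearMap.range_domRestrict B r
  have h2 : (LinearMap.ker (r.domRestrict B)).map B.subtype = B ⊓ LinearMap.ker r := by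
    ext x
    simp only [Submodule.mem_map, LinearMap.mem_ker, Submodule.mem_inf]
    constructor
    · rintro ⟨y, hy, rfl⟩
      exact ⟨y.2, hy⟩
    · rintro ⟨hx, hy⟩
      exact ⟨⟨x, hx⟩, hy, rfl⟩
  rw [← h, h1, ← h2, Submodule.finrank_map_subtype_eq]

/-- A space `B` of vectors over the two-element field is two-sparse if it is spanned by a finite
family of vectors such that every coordinate is nonzero in at most two members of the family.
The face boundaries of an embedded graph are such a family. -/
def IsTwoSparse {E : Type*} (B : Submodule (ZMod 2) (E → ZMod 2)) : Prop :=
  ∃ (m : ℕ) (f : Fin m → E → ZMod 2), Submodule.span (ZMod 2) (Set.range f) = B ∧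
    ∀ e, {i | f i e ≠ 0}.ncard ≤ 2

theorem isTwoSparse_span {E ι : Type*} [Finite ι] (f : ι → E → ZMod 2)
    (hf : ∀ e, {i | f i e ≠ 0}.ncard ≤ 2) :
    IsTwoSparse (Submodule.span (ZMod 2) (Set.range f)) := by
  obtain ⟨m, ⟨φ⟩⟩ := Finite.exists_equiv_fin ι
  refine ⟨m, f ∘ φ.symm, ?_, fun e => le_trans (le_of_eq ?_) (hf e)⟩
  · rw [Set.range_comp, φ.symm.surjective.range_eq, Set.image_univ]
  · exact Set.ncard_congr (fun i _ => φ.symm i) (fun i hi => hi)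
      (fun i j _ _ h => φ.symm.injective h) fun i hi => ⟨φ i, by simpa using hi, by simp⟩

/-- Pulling back coordinates (in particular forgetting some of them) preserves two-sparsity. On the
level of graphs, forgetting an edge is its contraction. -/
theorem IsTwoSparse.map_funLeft {E E' : Type*} {B : Submodule (ZMod 2) (E → ZMod 2)}
    (hB : IsTwoSparse B) (g : E' → E) :
    IsTwoSparse (B.map (LinearMap.funLeft (ZMod 2) (ZMod 2) g)) := by
  obtain ⟨m, f, rfl, hf⟩ := hB
  refine ⟨m, fun i => f i ∘ g, ?_, fun e => hf (g e)⟩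
  rw [Submodule.map_span, ← Set.range_comp]
  rfl

/-- The vectors vanishing at all coordinates in `S`. -/
def vanishOn {E : Type*} (S : Set E) : Submodule (ZMod 2) (E → ZMod 2) where
  carrier := {b | ∀ e ∈ S, b e = 0}
  zero_mem' := fun _ _ => rfl
  add_mem' := fun ha hb e he => by simp [ha e he, hb e he]
  smul_mem' := fun c a ha e he => by simp [ha e he]

theorem zmod_two_eq_one {x : ZMod 2} (h : x ≠ 0) : x = 1 := by
  revert x; decide

/-- Requiring one coordinate to vanish preserves two-sparsity: if that coordinate is nonzero in two
members of the family, these are replaced by their sum. On the level of graphs this is the deletion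
of an edge. -/
theorem IsTwoSparse.inf_vanishOn_singleton {E : Type*} {B : Submodule (ZMod 2) (E → ZMod 2)}
    (hB : IsTwoSparse B) (e : E) : IsTwoSparse (B ⊓ vanishOn {e}) := by
  obtain ⟨m, f, rfl, hf⟩ := hB
  by_cases h0 : ∀ i, f i e = 0
  · refine ⟨m, f, ?_, hf⟩
    refine (inf_eq_left.2 (Submodule.span_le.2 ?_)).symm
    rintro _ ⟨i, rfl⟩ e' he'
    rw [Set.mem_singleton_iff.1 he']
    exact h0 i
  push Not at h0
  obtain ⟨i₀, hi₀⟩ := h0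
  have h1 : f i₀ e = 1 := zmod_two_eq_one hi₀
  -- the projection along `f i₀` onto the vectors that vanish at `e`
  let L : (E → ZMod 2) →ₗ[ZMod 2] (E → ZMod 2) :=
    LinearMap.id - (LinearMap.proj e : (E → ZMod 2) →ₗ[ZMod 2] ZMod 2).smulRight (f i₀)
  have hL : ∀ v, L v = v - v e • f i₀ := fun v => rfl
  refine ⟨m, fun i => L (f i), ?_, fun e' => ?_⟩
  · have : Set.range (fun i => L (f i)) = L '' Set.range f := Set.range_comp L f
    rw [this, ← Submodule.map_span]
    apply le_antisymm
    · rintro _ ⟨v, hv, rfl⟩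
      refine ⟨?_, ?_⟩
      · rw [hL]
        exact Submodule.sub_mem _ hv
          (Submodule.smul_mem _ _ (Submodule.subset_span ⟨i₀, rfl⟩))
      · rintro e' rfl
        simp [hL, h1]
    · rintro v ⟨hv, hve⟩
      refine ⟨v, hv, ?_⟩
      rw [hL, show v e = 0 from hve e rfl]
      simp
  · by_cases he' : f i₀ e' = 0
    · refine le_trans (Set.ncard_le_ncard ?_ (Set.toFinite _)) (hf e')
      intro i hi
      simpa [hL, he'] using hi
    · have hs : {i | L (f i) e' ≠ 0} ⊆
          ({i | f i e' ≠ 0} \ {i₀}) ∪ ({i | f i e ≠ 0} \ {i₀}) := by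
        intro i hi
        have hne : i ≠ i₀ := by
          rintro rfl
          simp [hL, h1] at hi
        by_cases h2 : f i e = 0
        · left
          refine ⟨?_, hne⟩
          simpa [hL, h2] using hi
        · exact Or.inr ⟨h2, hne⟩
      have c1 := Set.ncard_sdiff_singleton_add_one (s := {i | f i e' ≠ 0}) (a := i₀) he'
        (Set.toFinite _)
      have c2 := Set.ncard_sdiff_singleton_add_one (s := {i | f i e ≠ 0}) (a := i₀) hi₀
        (Set.toFinite _)
      have c3 := Set.ncard_le_ncard hs (Set.toFinite _)
      have c4 := Set.ncard_union_le ({i | f i e' ≠ 0} \ {i₀}) ({i | f i e ≠ 0} \ {i₀})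
      have := hf e
      have := hf e'
      beta_reduce
      omega

theorem IsTwoSparse.inf_vanishOn {E : Type*} [Finite E] {B : Submodule (ZMod 2) (E → ZMod 2)}
    (hB : IsTwoSparse B) (S : Set E) : IsTwoSparse (B ⊓ vanishOn S) := by
  induction S, S.toFinite using Set.Finite.induction_on with
  | empty =>
    have : vanishOn (∅ : Set E) = ⊤ := by
      ext b
      exact ⟨fun _ => trivial, fun _ e he => he.elim⟩
    rwa [this, inf_top_eq]
  | @insert a s _ _ ih =>
    have : B ⊓ vanishOn (insert a s) = (B ⊓ vanishOn s) ⊓ vanishOn {a} := by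
      ext b
      constructor
      · rintro ⟨h1, h2⟩
        exact ⟨⟨h1, fun e he => h2 e (Or.inr he)⟩, fun e he => h2 e (Or.inl he)⟩
      · rintro ⟨⟨h1, h2⟩, h3⟩
        exact ⟨h1, fun e he => he.elim (h3 e) (h2 e)⟩
    rw [this]
    exact ih.inf_vanishOn_singleton a

/-- The inequality behind `w F ≤ 2 E` for graphs of girth `w`: a basis taken from a two-sparse family
together with the sum of the basis vectors still meets every coordinate at most twice. -/
theorem IsTwoSparse.mul_finrank_succ_le {E : Type*} {B : Submodule (ZMod 2) (E → ZMod 2)}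
    (hB : IsTwoSparse B) (S : Finset E) (w : ℕ)
    (hw : ∀ b ∈ B, b ≠ 0 → w ≤ (S.filter fun e => b e ≠ 0).card) (h0 : finrank (ZMod 2) B ≠ 0) :
    w * (finrank (ZMod 2) B + 1) ≤ 2 * S.card := by
  classical
  obtain ⟨m, f, rfl, hf⟩ := hB
  obtain ⟨κ, a, ha, hspan, hli⟩ := exists_linearIndependent' (ZMod 2) f
  have : Finite κ := Finite.of_injective a ha
  have := Fintype.ofFinite κ
  have hfin : finrank (ZMod 2) (Submodule.span (ZMod 2) (Set.range f)) = Fintype.card κ := by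
    rw [← hspan, finrank_span_eq_card hli]
  have hmem : ∀ i, f (a i) ∈ Submodule.span (ZMod 2) (Set.range f) :=
    fun i => Submodule.subset_span ⟨a i, rfl⟩
  rw [hfin] at h0 ⊢
  have hne : Nonempty κ := Fintype.card_pos_iff.1 (Nat.pos_of_ne_zero h0)
  -- the members of the basis, and their sum
  let v : Option κ → E → ZMod 2 := fun o => o.elim (∑ i, f (a i)) fun i => f (a i)
  have hv : ∀ o, w ≤ (S.filter fun e => v o e ≠ 0).card := by
    rintro (_ | i)
    · refine hw _ (Submodule.sum_mem _ fun i _ => hmem i) fun h => ?_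
      have h1 := Fintype.linearIndependent_iff.1 hli (fun _ => 1)
        (by simp only [one_smul]; exact h)
      exact one_ne_zero (h1 hne.some)
    · exact hw _ (hmem i) (hli.ne_zero i)
  have hcol : ∀ e, (Finset.univ.filter fun o => v o e ≠ 0).card ≤ 2 := by
    intro e
    have h1 : (Finset.univ.filter fun i => f (a i) e ≠ 0).card ≤ 2 := by
      refine le_trans ?_ (hf e)
      rw [← Set.ncard_coe_finset]
      refine Set.ncard_le_ncard_of_injOn a ?_ ha.injOn (Set.toFinite _)
      intro i hi
      simpa using hi
    have h2 : (∑ i, f (a i)) e = ((Finset.univ.filter fun i => f (a i) e ≠ 0).card : ZMod 2) := by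
      rw [Finset.sum_apply, Finset.card_filter, Nat.cast_sum]
      refine Finset.sum_congr rfl fun i _ => ?_
      by_cases h : f (a i) e = 0
      · simp [h]
      · simp [zmod_two_eq_one h]
    have h3 : (Finset.univ.filter fun o => v o e ≠ 0).card =
        (if (∑ i, f (a i)) e ≠ 0 then 1 else 0) +
          (Finset.univ.filter fun i => f (a i) e ≠ 0).card := by
      rw [Finset.card_filter, Fintype.sum_option, Finset.card_filter]
      rfl
    rw [h3, h2]
    generalize (Finset.univ.filter fun i => f (a i) e ≠ 0).card = c at *
    interval_cases c <;> decide
  calc w * (Fintype.card κ + 1) = ∑ _o : Option κ, w := by simp [mul_comm]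
    _ ≤ ∑ o, (S.filter fun e => v o e ≠ 0).card := Finset.sum_le_sum fun o _ => hv o
    _ = ∑ e ∈ S, (Finset.univ.filter fun o => v o e ≠ 0).card := by
        simp only [Finset.card_filter]
        exact Finset.sum_comm
    _ ≤ ∑ _e ∈ S, 2 := Finset.sum_le_sum fun e _ => hcol e
    _ = 2 * S.card := by simp [mul_comm]

/-- Dimensions of two-sparse spaces add up over disjoint sets of coordinates: if every two-sparse
subspace of `Z` has dimension at most `d`, then a two-sparse space of vectors composed of `n` vectors
of `Z` has dimension at most `n * d`. -/
theorem IsTwoSparse.finrank_le_mul {E : Type*} [Finite E] (Z : Submodule (ZMod 2) (E → ZMod 2))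
    (d : ℕ) (hZ : ∀ C ≤ Z, IsTwoSparse C → finrank (ZMod 2) C ≤ d) (n : ℕ)
    (B : Submodule (ZMod 2) (Fin n × E → ZMod 2)) (hB : IsTwoSparse B)
    (hBZ : ∀ b ∈ B, ∀ i, (fun e => b (i, e)) ∈ Z) : finrank (ZMod 2) B ≤ n * d := by
  induction n with
  | zero =>
    have : Subsingleton (Fin 0 × E → ZMod 2) := ⟨fun a b => funext fun x => x.1.elim0⟩
    have : Subsingleton B := ⟨fun a b => Subtype.ext (Subsingleton.elim _ _)⟩
    simp [finrank_zero_of_subsingleton]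
  | succ n ih =>
    let r := LinearMap.funLeft (ZMod 2) (ZMod 2) (fun x : Fin n × E => (x.1.succ, x.2))
    let s := LinearMap.funLeft (ZMod 2) (ZMod 2) (fun x : E => ((0 : Fin (n + 1)), x))
    have hker : LinearMap.ker r = vanishOn {x | x.1 ≠ 0} := by
      ext b
      constructor
      · rintro hb ⟨i, e⟩ hi
        obtain ⟨j, rfl⟩ := Fin.exists_succ_eq.2 hi
        exact congrFun hb (j, e)
      · intro hb
        exact funext fun x => hb _ (Fin.succ_ne_zero _)
    have h1 := finrank_map_add_finrank_inf_ker B r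
    have h2 := ih (B.map r) (hB.map_funLeft _) (by
      rintro _ ⟨b, hb, rfl⟩ i
      exact hBZ b hb i.succ)
    have h3 : finrank (ZMod 2) ((B ⊓ LinearMap.ker r).map s) ≤ d := by
      refine hZ _ ?_ ?_
      · rintro _ ⟨b, hb, rfl⟩
        exact hBZ b hb.1 0
      · rw [hker]
        exact (hB.inf_vanishOn _).map_funLeft _
    have h4 := finrank_map_add_finrank_inf_ker (B ⊓ LinearMap.ker r) s
    have h5 : B ⊓ LinearMap.ker r ⊓ LinearMap.ker s = ⊥ := by
      refine (Submodule.eq_bot_iff _).2 ?_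
      rintro b ⟨⟨-, hr⟩, hs⟩
      ext ⟨i, e⟩
      by_cases hi : i = 0
      · subst hi
        exact congrFun hs e
      · rw [hker] at hr
        exact hr _ hi
    rw [h5, finrank_bot, add_zero] at h4
    rw [Nat.succ_mul]
    omega

/-! ### The cycle space -/

/-- The coboundary of a vertex function: on an edge, the sum of the values at its two ends. -/
def coboundary {V : Type*} (φ : V → ZMod 2) : Sym2 V → ZMod 2 :=
  Sym2.lift ⟨fun x y => φ x + φ y, fun _ _ => add_comm _ _⟩

@[simp]
theorem coboundary_mk {V : Type*} (φ : V → ZMod 2) (x y : V) : coboundary φ s(x, y) = φ x + φ y :=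
  rfl

theorem zmod_two_add_eq_zero {x y : ZMod 2} : x + y = 0 ↔ x = y := by
  revert x y; decide

/-- The cycle space of `G` over the two-element field: the edge vectors orthogonal to all
coboundaries. Edge vectors are functions on all unordered pairs that vanish at the non-edges. -/
def cycleSpace {V : Type*} [Fintype V] [DecidableEq V] (G : SimpleGraph V) :
    Submodule (ZMod 2) (Sym2 V → ZMod 2) where
  carrier := {z | (∀ e ∉ G.edgeSet, z e = 0) ∧ ∀ φ, ∑ e, coboundary φ e * z e = 0}
  zero_mem' := ⟨fun _ _ => rfl, fun _ => by simp⟩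
  add_mem' := fun ha hb => ⟨fun e he => by simp [ha.1 e he, hb.1 e he], fun φ => by
    simp [mul_add, Finset.sum_add_distrib, ha.2 φ, hb.2 φ]⟩
  smul_mem' := fun c a ha => ⟨fun e he => by simp [ha.1 e he], fun φ => by
    simp only [Pi.smul_apply, smul_eq_mul, mul_left_comm _ c]
    rw [← Finset.mul_sum, ha.2 φ, mul_zero]⟩

/-- The algebraic surrogate for `Euler genus at most g`: up to codimension `g`, the cycle space is
spanned by a two-sparse family. For `g = 0` this is MacLane's planarity criterion. -/
def SparseGenusLE {V : Type*} [Fintype V] [DecidableEq V] (G : SimpleGraph V) (g : ℕ) : Prop :=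
  ∃ B ≤ cycleSpace G, IsTwoSparse B ∧ finrank (ZMod 2) (cycleSpace G) ≤ finrank (ZMod 2) B + g

theorem eq_of_walk {V α : Type*} {G : SimpleGraph V} {p : V → α}
    (h : ∀ u v, G.Adj u v → p u = p v) {u v : V} (q : G.Walk u v) : p u = p v := by
  induction q with
  | nil => rfl
  | cons huv _ ih => exact (h _ _ huv).trans ih

/-- The cycle space has dimension at most `|E| - |V| + c`, where `c` is the number of components:
the incidence matrix has the same row rank and column rank. -/
theorem finrank_cycleSpace_add_card_le {V : Type*} [Fintype V] [DecidableEq V]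
    (G : SimpleGraph V) : finrank (ZMod 2) (cycleSpace G) + Nat.card V ≤
      Nat.card G.edgeSet + Nat.card G.ConnectedComponent := by
  classical
  have := Fintype.ofFinite G.ConnectedComponent
  let M : Matrix G.edgeSet V (ZMod 2) := fun e v => coboundary (Pi.single v 1) e
  have hM : ∀ (φ : V → ZMod 2) e, ∑ v, coboundary (Pi.single v 1) e * φ v = coboundary φ e := by
    intro φ e
    induction e with
    | h x y => simp [add_mul, Finset.sum_add_distrib, Pi.single_apply]
  have hker : finrank (ZMod 2) (LinearMap.ker M.mulVecLin) ≤ Nat.card G.ConnectedComponent := by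
    have hle : LinearMap.ker M.mulVecLin ≤
        LinearMap.range (LinearMap.funLeft (ZMod 2) (ZMod 2) G.connectedComponentMk) := by
      intro φ hφ
      have hadj : ∀ x y, G.Adj x y → φ x = φ y := fun x y h => by
        have := congrFun hφ ⟨s(x, y), h⟩
        rw [← zmod_two_add_eq_zero]
        exact (hM φ s(x, y)).symm.trans this
      exact ⟨SimpleGraph.ConnectedComponent.lift φ fun v w p _ => eq_of_walk hadj p, rfl⟩
    refine (Submodule.finrank_mono hle).trans ((LinearMap.finrank_range_le _).trans ?_)
    simp
  have hZ : finrank (ZMod 2) (cycleSpace G) ≤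
      finrank (ZMod 2) (LinearMap.ker M.transpose.mulVecLin) := by
    let r := LinearMap.funLeft (ZMod 2) (ZMod 2) (Subtype.val : G.edgeSet → Sym2 V)
    have h1 := finrank_map_add_finrank_inf_ker (cycleSpace G) r
    have h2 : cycleSpace G ⊓ LinearMap.ker r = ⊥ := by
      refine (Submodule.eq_bot_iff _).2 ?_
      rintro z ⟨hz, hr⟩
      ext e
      by_cases he : e ∈ G.edgeSet
      · exact congrFun hr ⟨e, he⟩
      · exact hz.1 e he
    rw [h2, finrank_bot, add_zero] at h1
    rw [← h1]
    refine Submodule.finrank_mono ?_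
    rintro _ ⟨z, hz, rfl⟩
    refine LinearMap.mem_ker.2 (funext fun v => ?_)
    have h3 := hz.2 (Pi.single v 1)
    rw [← Fintype.sum_subtype_add_sum_subtype (fun e => e ∈ G.edgeSet),
      Finset.sum_eq_zero (s := (Finset.univ : Finset {e // e ∉ G.edgeSet}))
        (fun e _ => by rw [hz.1 _ e.2, mul_zero]), add_zero] at h3
    exact h3
  have e1 := LinearMap.finrank_range_add_finrank_ker M.mulVecLin
  have e2 := LinearMap.finrank_range_add_finrank_ker M.transpose.mulVecLin
  have e3 : finrank (ZMod 2) (LinearMap.range M.transpose.mulVecLin) =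
      finrank (ZMod 2) (LinearMap.range M.mulVecLin) := Matrix.rank_transpose M
  simp only [finrank_fintype_fun_eq_card] at e1 e2
  rw [Nat.card_eq_fintype_card (α := V), Nat.card_eq_fintype_card (α := G.edgeSet)]
  omega

/-- Summation by parts, over the two darts of each edge. -/
theorem sum_coboundary_mul {V : Type*} [Fintype V] [DecidableEq V] (G : SimpleGraph V)
    [DecidableRel G.Adj] (φ : V → ZMod 2) (z : Sym2 V → ZMod 2) (hz : ∀ e ∉ G.edgeSet, z e = 0) :
    ∑ e, coboundary φ e * z e = ∑ d : G.Dart, φ d.fst * z d.edge := by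
  rw [← Finset.sum_fiberwise (s := Finset.univ) (g := fun d : G.Dart => d.edge)]
  refine Finset.sum_congr rfl fun e _ => ?_
  by_cases he : e ∈ G.edgeSet
  · induction e with
    | h x y =>
      have hxy : G.Adj x y := he
      let d : G.Dart := ⟨(x, y), hxy⟩
      have hd : (Finset.univ.filter fun d' : G.Dart => d'.edge = s(x, y)) = {d, d.symm} :=
        d.edge_fiber
      rw [hd, Finset.sum_pair d.symm_ne.symm]
      simp [d, SimpleGraph.Dart.edge, SimpleGraph.Dart.symm, add_mul, Sym2.eq_swap]
  · rw [hz e he, mul_zero]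
    refine (Finset.sum_eq_zero fun d hd => ?_).symm
    rw [(Finset.mem_filter.1 hd).2, hz e he, mul_zero]

/-! ### Face boundaries of an embedding -/

namespace SurfaceEmbedding

variable {V : Type*} {G : SimpleGraph V} (S : SurfaceEmbedding G)

/-- The face that a flag lies in. -/
def face (x : Flag G) : S.Face := Quot.mk _ x

theorem face_corner (x : Flag G) : S.face (S.corner x) = S.face x :=
  (Quot.sound (r := fun a b : Flag G => b = S.corner a ∨ b = a.otherEnd) (Or.inl rfl)).symm

theorem face_otherEnd (x : Flag G) : S.face x.otherEnd = S.face x :=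
  (Quot.sound (r := fun a b : Flag G => b = S.corner a ∨ b = a.otherEnd) (Or.inr rfl)).symm

open Classical in
/-- The boundary map from face vectors to edge vectors: the value at an edge is the sum of the
values at the faces on its two sides. -/
noncomputable def faceBoundary : (S.Face → ZMod 2) →ₗ[ZMod 2] (Sym2 V → ZMod 2) where
  toFun c := Sym2.lift ⟨fun u v =>
    if h : G.Adj u v then c (S.face (⟨(u, v), h⟩, false)) + c (S.face (⟨(u, v), h⟩, true)) else 0,
    fun u v => by
      beta_reduce
      by_cases h : G.Adj u v
      · rw [dif_pos h, dif_pos h.symm, ← S.face_otherEnd (⟨(u, v), h⟩, false),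
          ← S.face_otherEnd (⟨(u, v), h⟩, true)]
        rfl
      · rw [dif_neg h, dif_neg fun h' => h h'.symm]⟩
  map_add' a b := by
    ext e
    induction e with
    | h u v =>
      simp only [Sym2.lift_mk, Pi.add_apply]
      split_ifs
      · ring
      · simp
  map_smul' r a := by
    ext e
    induction e with
    | h u v =>
      simp only [Sym2.lift_mk, Pi.smul_apply, RingHom.id_apply, smul_eq_mul]
      split_ifs
      · ring
      · simp

theorem faceBoundary_edge (c : S.Face → ZMod 2) (d : G.Dart) :
    S.faceBoundary c d.edge = c (S.face (d, false)) + c (S.face (d, true)) := by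
  rcases d with ⟨⟨u, v⟩, h⟩
  exact dif_pos h

theorem faceBoundary_of_not_mem (c : S.Face → ZMod 2) {e : Sym2 V} (he : e ∉ G.edgeSet) :
    S.faceBoundary c e = 0 := by
  induction e with
  | h u v => exact dif_neg he

/-- Face boundaries are cycles, since the flags of a face at a vertex are paired up by corners. -/
theorem faceBoundary_mem_cycleSpace [Fintype V] [DecidableEq V] (c : S.Face → ZMod 2) :
    S.faceBoundary c ∈ cycleSpace G := by
  classical
  refine ⟨fun e he => S.faceBoundary_of_not_mem c he, fun φ => ?_⟩
  rw [sum_coboundary_mul G φ _ fun e he => S.faceBoundary_of_not_mem c he]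
  have h1 : ∑ d : G.Dart, φ d.fst * S.faceBoundary c d.edge =
      ∑ x : Flag G, φ x.1.fst * c (S.face x) := by
    rw [Fintype.sum_prod_type]
    refine Finset.sum_congr rfl fun d _ => ?_
    rw [S.faceBoundary_edge, Fintype.sum_bool, mul_add, add_comm]
  rw [h1]
  refine Finset.sum_involution (fun x _ => S.corner x) (fun x _ => ?_) (fun x _ _ => S.corner_ne x)
    (fun x _ => Finset.mem_univ _) fun x _ => S.corner_corner x
  rw [S.corner_vertex, S.face_corner, zmod_two_add_eq_zero]

instance [Finite V] : Finite S.Face := by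
  classical
  have := Fintype.ofFinite V
  exact Quot.finite _

theorem isTwoSparse_range_faceBoundary [Finite V] :
    IsTwoSparse (LinearMap.range S.faceBoundary) := by
  classical
  have hfin : Finite S.Face := inferInstance
  have := Fintype.ofFinite S.Face
  have h : LinearMap.range S.faceBoundary = Submodule.span (ZMod 2)
      (Set.range fun F : S.Face => S.faceBoundary (Pi.single F 1)) := by
    rw [LinearMap.range_eq_map, ← (Pi.basisFun (ZMod 2) S.Face).span_eq, Submodule.map_span,
      ← Set.range_comp]
    congr 2
  rw [h]
  refine isTwoSparse_span _ fun e => ?_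
  by_cases he : e ∈ G.edgeSet
  · induction e with
    | h u v =>
      have huv : G.Adj u v := he
      refine (Set.ncard_le_ncard (t := {S.face (⟨(u, v), huv⟩, false),
        S.face (⟨(u, v), huv⟩, true)}) ?_ (Set.toFinite _)).trans (Set.ncard_insert_le _ _ |>.trans (by simp))
      intro F hF
      by_contra hcon
      simp only [Set.mem_insert_iff, Set.mem_singleton_iff, not_or] at hcon
      refine hF ((S.faceBoundary_edge _ ⟨(u, v), huv⟩).trans ?_)
      rw [Pi.single_eq_of_ne (Ne.symm hcon.1), Pi.single_eq_of_ne (Ne.symm hcon.2), add_zero]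
  · simp [S.faceBoundary_of_not_mem _ he]

/-- A set of faces with empty boundary is a union of components of the surface: at each vertex the
flags are linked by corners and edge crossings. -/
theorem eq_of_faceBoundary_eq_zero {c : S.Face → ZMod 2} (hc : S.faceBoundary c = 0)
    {x y : Flag G} (h : x.1.fst = y.1.fst) : c (S.face x) = c (S.face y) := by
  have hside : ∀ x : Flag G, c (S.face x.otherSide) = c (S.face x) := by
    rintro ⟨d, b⟩
    have := S.faceBoundary_edge c d
    rw [hc] at this
    have h2 := zmod_two_add_eq_zero.1 this.symm
    cases b
    · exact h2.symm
    · exact h2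
  replace h := S.rotation x y h
  induction h with
  | rel a b hab =>
    rcases hab with rfl | rfl
    · rw [S.face_corner]
    · rw [hside]
  | refl => rfl
  | symm _ _ _ ih => exact ih.symm
  | trans _ _ _ _ _ ih1 ih2 => exact ih1.trans ih2

/-- The face boundaries span a space of dimension at least `|F| - c`, where every isolated vertex
accounts for one more face. -/
theorem card_face_add_card_isolated_le [Fintype V] [DecidableEq V] :
    Nat.card S.Face + Nat.card {v : V // ∀ w, ¬ G.Adj v w} ≤
      finrank (ZMod 2) (LinearMap.range S.faceBoundary) + Nat.card G.ConnectedComponent := by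
  classical
  have := Fintype.ofFinite S.Face
  have := Fintype.ofFinite G.ConnectedComponent
  let Iso := {v : V // ∀ w, ¬ G.Adj v w}
  let Ψ : (S.Face → ZMod 2) × (Iso → ZMod 2) →ₗ[ZMod 2] (Sym2 V → ZMod 2) :=
    S.faceBoundary ∘ₗ LinearMap.fst _ _ _
  have hrange : LinearMap.range Ψ = LinearMap.range S.faceBoundary :=
    LinearMap.range_comp_of_range_eq_top _ (LinearMap.range_eq_top.2 LinearMap.fst_surjective)
  let comp : S.Face → G.ConnectedComponent :=
    Quot.lift (fun x => G.connectedComponentMk x.1.fst) (by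
      rintro x _ (rfl | rfl)
      · rw [S.corner_vertex]
      · exact SimpleGraph.ConnectedComponent.sound x.1.adj.reachable)
  let Φ : (G.ConnectedComponent → ZMod 2) →ₗ[ZMod 2] (S.Face → ZMod 2) × (Iso → ZMod 2) :=
    (LinearMap.funLeft _ _ comp).prod
      (LinearMap.funLeft _ _ fun v : Iso => G.connectedComponentMk v.1)
  have hle : LinearMap.ker Ψ ≤ LinearMap.range Φ := by
    rintro ⟨c, i⟩ hci
    have hc : S.faceBoundary c = 0 := hci
    let p : V → ZMod 2 := fun v => if hv : ∀ w, ¬ G.Adj v w then i ⟨v, hv⟩ else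
      c (S.face (⟨(v, (not_forall_not.1 hv).choose), (not_forall_not.1 hv).choose_spec⟩, false))
    have hp : ∀ x : Flag G, p x.1.fst = c (S.face x) := by
      intro x
      have hv : ¬ ∀ w, ¬ G.Adj x.1.fst w := fun h => h _ x.1.adj
      have : p x.1.fst = _ := dif_neg hv
      rw [this]
      exact S.eq_of_faceBoundary_eq_zero hc rfl
    have hadj : ∀ u v, G.Adj u v → p u = p v := fun u v h => by
      have h1 := hp (⟨(u, v), h⟩, false)
      have h2 := hp (Flag.otherEnd (⟨(u, v), h⟩, false))
      rw [S.face_otherEnd] at h2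
      exact h1.trans h2.symm
    refine ⟨SimpleGraph.ConnectedComponent.lift p fun v w q _ => eq_of_walk hadj q, ?_⟩
    refine Prod.ext (funext fun F => ?_) (funext fun v => ?_)
    · induction F using Quot.ind with
      | mk x => exact hp x
    · exact dif_pos v.2
  have h1 := LinearMap.finrank_range_add_finrank_ker Ψ
  have h2 : finrank (ZMod 2) (LinearMap.ker Ψ) ≤ Nat.card G.ConnectedComponent := by
    refine (Submodule.finrank_mono hle).trans ((LinearMap.finrank_range_le _).trans ?_)
    simp
  rw [hrange, finrank_prod, finrank_fintype_fun_eq_card, finrank_fintype_fun_eq_card,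
    ← Nat.card_eq_fintype_card, ← Nat.card_eq_fintype_card] at h1
  change Nat.card S.Face + Nat.card Iso ≤ _
  omega

end SurfaceEmbedding

/-- In an embedding of Euler genus `g`, the face boundaries have codimension at most `g` in the
cycle space. -/
theorem EulerGenusLE.sparseGenusLE {V : Type*} [Fintype V] [DecidableEq V] {G : SimpleGraph V}
    {g : ℕ} (h : EulerGenusLE G g) : SparseGenusLE G g := by
  obtain ⟨S, hS⟩ := h
  refine ⟨LinearMap.range S.faceBoundary, ?_, S.isTwoSparse_range_faceBoundary, ?_⟩
  · rintro _ ⟨c, rfl⟩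
    exact S.faceBoundary_mem_cycleSpace c
  · have h1 := finrank_cycleSpace_add_card_le G
    have h2 := S.card_face_add_card_isolated_le
    rw [SurfaceEmbedding.eulerGenus, SurfaceEmbedding.eulerChar] at hS
    omega

/-! ### Connected sets -/

/-- A property that spreads along the edges inside a connected set holds on the whole set once it
holds somewhere. -/
theorem connected_induction {V : Type*} {G : SimpleGraph V} {X : Set V}
    (hX : (G.induce X).Connected) {P : V → Prop} {x : V} (hx : x ∈ X) (h0 : P x)
    (hstep : ∀ u ∈ X, ∀ v ∈ X, G.Adj u v → P u → P v) : ∀ y ∈ X, P y := by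
  intro y hy
  have h := (SimpleGraph.reachable_iff_reflTransGen _ _).1 (hX.preconnected ⟨x, hx⟩ ⟨y, hy⟩)
  have key : ∀ z : X, Relation.ReflTransGen (G.induce X).Adj ⟨x, hx⟩ z → P z := by
    intro z hz
    induction hz with
    | refl => exact h0
    | tail _ hadj ih => exact hstep _ (Subtype.prop _) _ (Subtype.prop _) hadj ih
  exact key _ h

/-- Converse of `connected_induction`, from one base point. -/
theorem connected_of_induction {V : Type*} {G : SimpleGraph V} {X : Set V} {x : V} (hx : x ∈ X)
    (h : ∀ P : V → Prop, P x → (∀ u ∈ X, ∀ v ∈ X, G.Adj u v → P u → P v) → ∀ y ∈ X, P y) :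
    (G.induce X).Connected := by
  have key : ∀ y : X, (G.induce X).Reachable ⟨x, hx⟩ y := by
    rintro ⟨y, hy⟩
    obtain ⟨_, h'⟩ := h (fun y => ∃ hy : y ∈ X, (G.induce X).Reachable ⟨x, hx⟩ ⟨y, hy⟩)
      ⟨hx, SimpleGraph.Reachable.refl _⟩ (by
        rintro u _ v hv huv ⟨hu, hr⟩
        exact ⟨hv, hr.trans (SimpleGraph.Adj.reachable (by exact huv))⟩) y hy
    exact h'
  exact (SimpleGraph.connected_iff _).2 ⟨fun a b => (key a).symm.trans (key b), ⟨⟨x, hx⟩⟩⟩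

theorem connected_union {V : Type*} {G : SimpleGraph V} {X Y : Set V}
    (hX : (G.induce X).Connected) (hY : (G.induce Y).Connected) (h : (X ∩ Y).Nonempty) :
    (G.induce (X ∪ Y)).Connected := by
  obtain ⟨z, hzX, hzY⟩ := h
  refine connected_of_induction (Or.inl hzX) fun P hP hstep y hy => ?_
  rcases hy with hy | hy
  · exact connected_induction hX hzX hP
      (fun u hu v hv => hstep u (Or.inl hu) v (Or.inl hv)) y hy
  · exact connected_induction hY hzY hP
      (fun u hu v hv => hstep u (Or.inr hu) v (Or.inr hv)) y hy

theorem connected_union_of_adj {V : Type*} {G : SimpleGraph V} {X Y : Set V}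
    (hX : (G.induce X).Connected) (hY : (G.induce Y).Connected) {x y : V} (hx : x ∈ X)
    (hy : y ∈ Y) (h : G.Adj x y) : (G.induce (X ∪ Y)).Connected := by
  refine connected_of_induction (Or.inl hx) fun P hP hstep z hz => ?_
  rcases hz with hz | hz
  · exact connected_induction hX hx hP
      (fun u hu v hv => hstep u (Or.inl hu) v (Or.inl hv)) z hz
  · exact connected_induction hY hy (hstep x (Or.inl hx) y (Or.inr hy) h hP)
      (fun u hu v hv => hstep u (Or.inr hu) v (Or.inr hv)) z hz

/-- Replacing every vertex of a connected set by its branch set yields a connected set. -/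
theorem connected_biUnion {V W : Type*} {G : SimpleGraph V} {H : SimpleGraph W} {X : W → Set V}
    (hX : ∀ w, (G.induce (X w)).Connected)
    (hadj : ∀ w w', H.Adj w w' → ∃ x ∈ X w, ∃ y ∈ X w', G.Adj x y) {Y : Set W}
    (hY : (H.induce Y).Connected) : (G.induce (⋃ w ∈ Y, X w)).Connected := by
  obtain ⟨w₀, hw₀⟩ := hY.nonempty
  obtain ⟨x₀, hx₀⟩ := (hX w₀).nonempty
  refine connected_of_induction (Set.mem_biUnion hw₀ hx₀) fun P hP hstep => ?_
  have hin : ∀ w ∈ Y, (∃ x ∈ X w, P x) → ∀ x ∈ X w, P x := by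
    rintro w hw ⟨x, hx, hPx⟩
    exact connected_induction (hX w) hx hPx fun u hu v hv =>
      hstep u (Set.mem_biUnion hw hu) v (Set.mem_biUnion hw hv)
  have key := connected_induction hY hw₀ (P := fun w => ∀ x ∈ X w, P x) (hin w₀ hw₀ ⟨x₀, hx₀, hP⟩)
    (by
      intro w hw w' hw' hww' h
      obtain ⟨x, hx, y, hy, hxy⟩ := hadj w w' hww'
      exact hin w' hw' ⟨y, hy, hstep x (Set.mem_biUnion hw hx) y (Set.mem_biUnion hw' hy) hxy
        (h x hx)⟩)
  intro y hy
  obtain ⟨w, hw, hyw⟩ := Set.mem_iUnion₂.1 hy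
  exact key w hw y hyw

/-! ### Tree decompositions -/

/-- The vertices of the tree `T` on the side of `d` of the edge `td`. -/
def treeSide {ι : Type*} (T : SimpleGraph ι) (t d : ι) : Set ι :=
  {s | (T.deleteEdges {s(t, d)}).Reachable d s}

theorem not_mem_treeSide {ι : Type*} {T : SimpleGraph ι} (hT : T.IsAcyclic) {t d : ι}
    (h : T.Adj t d) : t ∉ treeSide T t d := by
  intro ht
  have hb := SimpleGraph.isAcyclic_iff_forall_adj_isBridge.1 hT h
  exact SimpleGraph.isBridge_iff.1 hb ht.symm

/-- The two sides of an edge of a tree are disjoint. -/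
theorem disjoint_treeSide {ι : Type*} {T : SimpleGraph ι} (hT : T.IsAcyclic) {t d : ι}
    (h : T.Adj t d) : Disjoint (treeSide T t d) (treeSide T d t) := by
  refine Set.disjoint_left.2 fun s h1 h2 => ?_
  rw [treeSide, Sym2.eq_swap] at h2
  have hb := SimpleGraph.isAcyclic_iff_forall_adj_isBridge.1 hT h
  exact SimpleGraph.isBridge_iff.1 hb (SimpleGraph.Reachable.trans h2 (SimpleGraph.Reachable.symm h1))

/-- Steps inside a side of the edge `td` that do not go to `t` stay on that side. -/
theorem treeSide_step {ι : Type*} {T : SimpleGraph ι} {t d s s' : ι} (hs : s ∈ treeSide T t d)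
    (hadj : T.Adj s s') (h1 : s ≠ t) (h2 : s' ≠ t) : s' ∈ treeSide T t d := by
  refine SimpleGraph.Reachable.trans hs (SimpleGraph.Adj.reachable ?_)
  rw [SimpleGraph.deleteEdges_adj]
  refine ⟨hadj, fun h => ?_⟩
  rcases Sym2.eq_iff.1 (Set.mem_singleton_iff.1 h) with ⟨h, -⟩ | ⟨-, h⟩
  · exact h1 h
  · exact h2 h

theorem exists_mem_treeSide {ι : Type*} {T : SimpleGraph ι} (hT : T.Connected) {t s : ι}
    (h : s ≠ t) : ∃ d, T.Adj t d ∧ s ∈ treeSide T t d := by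
  have hr := (SimpleGraph.reachable_iff_reflTransGen _ _).1 (hT.preconnected t s)
  induction hr with
  | refl => exact absurd rfl h
  | @tail b c _ hbc ih =>
    by_cases hb : b = t
    · subst hb
      exact ⟨c, hbc, SimpleGraph.Reachable.refl _⟩
    · obtain ⟨d, hd, hbd⟩ := ih hb
      exact ⟨d, hd, treeSide_step hbd hbc hb h⟩

namespace TreeDecomposition

variable {V ι : Type*} {G : SimpleGraph V} {T : SimpleGraph ι} (D : TreeDecomposition G T)

theorem isAcyclic (D : TreeDecomposition G T) : T.IsAcyclic := D.isTree.isAcyclic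

/-- A vertex outside the bag of `t` lives on a single side of `t`. -/
theorem mem_treeSide_of_not_mem_bag {t d s s' : ι} {x : V} (hx : x ∉ D.bag t) (hs : x ∈ D.bag s)
    (hs' : x ∈ D.bag s') (h : s ∈ treeSide T t d) : s' ∈ treeSide T t d := by
  refine connected_induction (D.connected_bags x) (P := fun s => s ∈ treeSide T t d) hs h
    (fun u hu v hv huv hu' => treeSide_step hu' huv ?_ ?_) s' hs'
  · rintro rfl
    exact hx hu
  · rintro rfl
    exact hx hv

/-- A vertex in the bag of `t` and in a bag on the side of `d` lies in the adhesion set. -/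
theorem mem_bag_of_mem_treeSide {t d s : ι} {x : V} (hd : T.Adj t d) (hx : x ∈ D.bag t)
    (hs : x ∈ D.bag s) (h : s ∈ treeSide T t d) : x ∈ D.bag d := by
  by_contra hxd
  refine not_mem_treeSide D.isAcyclic hd ?_
  refine connected_induction (D.connected_bags x) (P := fun s => s ∈ treeSide T t d) hs h
    (fun u hu v hv huv hu' => SimpleGraph.Reachable.trans hu' (SimpleGraph.Adj.reachable ?_)) t hx
  rw [SimpleGraph.deleteEdges_adj]
  refine ⟨huv, fun h => ?_⟩
  rcases Sym2.eq_iff.1 (Set.mem_singleton_iff.1 h) with ⟨-, rfl⟩ | ⟨rfl, -⟩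
  · exact hxd hv
  · exact hxd hu

/-- The trace of a connected set on a bag is connected in the torso: whenever a path leaves the bag,
it does so through an adhesion set, and it returns to the same one. -/
theorem connected_torso_induce (t : ι) {X : Set V} (hX : (G.induce X).Connected)
    (hne : (X ∩ D.bag t).Nonempty) : ((D.torso t).induce {v : D.bag t | (v : V) ∈ X}).Connected := by
  obtain ⟨x₀, hx₀, hxt₀⟩ := hne
  refine connected_of_induction (x := ⟨x₀, hxt₀⟩) hx₀ fun P hP hstep => ?_
  let Q : V → Prop := fun v =>
    (∀ h : v ∈ D.bag t, P ⟨v, h⟩) ∧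
    (v ∉ D.bag t → ∃ d, T.Adj t d ∧ (∀ s, v ∈ D.bag s → s ∈ treeSide T t d) ∧
      ∃ y, ∃ hy : y ∈ D.bag t, y ∈ X ∧ y ∈ D.bag d ∧ P ⟨y, hy⟩)
  have key := connected_induction hX (P := Q) hx₀ ⟨fun _ => hP, fun h => absurd hxt₀ h⟩ ?_
  · rintro ⟨y, hyt⟩ hy
    exact (key y hy).1 hyt
  intro u hu v hv huv hQ
  obtain ⟨s, hus, hvs⟩ := D.exists_edge_bag u v huv
  by_cases hut : u ∈ D.bag t
  · refine ⟨fun hvt => ?_, fun hvt => ?_⟩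
    · exact hstep ⟨u, hut⟩ hu ⟨v, hvt⟩ hv ⟨fun h => huv.ne (congrArg Subtype.val h), Or.inl huv⟩
        (hQ.1 hut)
    · have hst : s ≠ t := by
        rintro rfl
        exact hvt hvs
      obtain ⟨d, hd, hsd⟩ := exists_mem_treeSide D.isTree.connected hst
      exact ⟨d, hd, fun s' hs' => D.mem_treeSide_of_not_mem_bag hvt hvs hs' hsd, u, hut, hu,
        D.mem_bag_of_mem_treeSide hd hut hus hsd, hQ.1 hut⟩
  · obtain ⟨d, hd, hside, y, hyt, hyX, hyd, hPy⟩ := hQ.2 hut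
    refine ⟨fun hvt => ?_, fun hvt => ?_⟩
    · by_cases hyv : y = v
      · subst hyv
        exact hPy
      · exact hstep ⟨y, hyt⟩ hyX ⟨v, hvt⟩ hv ⟨fun h => hyv (congrArg Subtype.val h),
          Or.inr ⟨d, hd, hyd, D.mem_bag_of_mem_treeSide hd hvt hvs (hside s hus)⟩⟩ hPy
    · exact ⟨d, hd, fun s' hs' => D.mem_treeSide_of_not_mem_bag hvt hvs hs' (hside s hus),
        y, hyt, hyX, hyd, hPy⟩

/-- Disjoint connected sets that are joined by an edge and meet the bag of `t` have traces joined by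
an edge of the torso. -/
theorem exists_adj_torso (t : ι) {X Y : Set V} (hX : (G.induce X).Connected)
    (hY : (G.induce Y).Connected) (hXt : (X ∩ D.bag t).Nonempty) (hYt : (Y ∩ D.bag t).Nonempty)
    (hdisj : Disjoint X Y) (hadj : ∃ x ∈ X, ∃ y ∈ Y, G.Adj x y) :
    ∃ x : D.bag t, (x : V) ∈ X ∧ ∃ y : D.bag t, (y : V) ∈ Y ∧ (D.torso t).Adj x y := by
  by_contra! hcon
  obtain ⟨x, hx, y, hy, hxy⟩ := hadj
  obtain ⟨x₀, hx₀, hxt⟩ := hXt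
  obtain ⟨y₀, hy₀, hyt⟩ := hYt
  have hconn := D.connected_torso_induce t (connected_union_of_adj hX hY hx hy hxy)
    ⟨x₀, Or.inl hx₀, hxt⟩
  refine Set.disjoint_left.1 hdisj (connected_induction hconn (P := fun v => (v : V) ∈ X)
    (x := ⟨x₀, hxt⟩) (Or.inl hx₀) hx₀ (fun u _ v hv huv hu => ?_) ⟨y₀, hyt⟩ (Or.inr hy₀)) hy₀
  exact hv.resolve_right fun hvY => hcon u hu v hvY huv

/-- A connected set avoiding an adhesion set `bag t ∩ bag d` and containing a vertex that lives
strictly on the side of `d` does not meet the bag of `t`. -/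
theorem disjoint_bag_of_avoids_adhesion {t d : ι} (hd : T.Adj t d) {X : Set V}
    (hX : (G.induce X).Connected) (hav : ∀ x ∈ X, x ∈ D.bag t → x ∉ D.bag d) {x : V} (hx : x ∈ X)
    (hxt : x ∉ D.bag t) {s : ι} (hxs : x ∈ D.bag s) (hs : s ∈ treeSide T t d) :
    (∀ y ∈ X, y ∉ D.bag t) ∧ ∀ y ∈ X, ∀ s', y ∈ D.bag s' → s' ∈ treeSide T t d := by
  have key := connected_induction hX
    (P := fun y => y ∉ D.bag t ∧ ∀ s', y ∈ D.bag s' → s' ∈ treeSide T t d) hx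
    ⟨hxt, fun s' hs' => D.mem_treeSide_of_not_mem_bag hxt hxs hs' hs⟩ (by
      rintro u - v hv huv ⟨-, hside⟩
      obtain ⟨r, hur, hvr⟩ := D.exists_edge_bag u v huv
      have hvt : v ∉ D.bag t := fun h =>
        hav v hv h (D.mem_bag_of_mem_treeSide hd h hvr (hside r hur))
      exact ⟨hvt, fun s' hs' => D.mem_treeSide_of_not_mem_bag hvt hvr hs' (hside r hur)⟩)
  exact ⟨fun y hy => (key y hy).1, fun y hy => (key y hy).2⟩

/-- A connected set that does not meet the bag of `t` lives on a single side of `t`. -/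
theorem exists_treeSide_of_disjoint_bag {t : ι} {X : Set V} (hX : (G.induce X).Connected)
    (hav : ∀ x ∈ X, x ∉ D.bag t) :
    ∃ d, T.Adj t d ∧ ∀ x ∈ X, ∀ s, x ∈ D.bag s → s ∈ treeSide T t d := by
  obtain ⟨x, hx⟩ := hX.nonempty
  obtain ⟨s, hs⟩ := D.exists_mem_bag x
  have hst : s ≠ t := by
    rintro rfl
    exact hav x hx hs
  obtain ⟨d, hd, hsd⟩ := exists_mem_treeSide D.isTree.connected hst
  exact ⟨d, hd, (D.disjoint_bag_of_avoids_adhesion hd hX (fun x hx h => absurd h (hav x hx)) hx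
    (hav x hx) hs hsd).2⟩

/-- Pairwise intersecting connected sets are all met by one bag. Otherwise every tree vertex points
along an edge towards a set missing its bag; as there are fewer edges than vertices, some edge is
pointed along in both directions, and the two sets involved are disjoint. -/
theorem exists_bag_meets_all [Finite ι] {α : Type*} (C : α → Set V)
    (hC : ∀ a, (G.induce (C a)).Connected) (hmeet : ∀ a b, (C a ∩ C b).Nonempty) :
    ∃ t, ∀ a, (C a ∩ D.bag t).Nonempty := by
  classical
  have := Fintype.ofFinite ι
  by_contra! hcon
  choose a ha using hcon
  have hav : ∀ t, ∀ x ∈ C (a t), x ∉ D.bag t := fun t x hx hxt =>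
    (ha t ▸ (⟨hx, hxt⟩ : x ∈ C (a t) ∩ D.bag t) : x ∈ (∅ : Set V)).elim
  choose d hd hside using fun t => D.exists_treeSide_of_disjoint_bag (hC (a t)) (hav t)
  have hcard := D.isTree.card_edgeFinset
  obtain ⟨t, -, t', -, hne, heq⟩ := Finset.exists_ne_map_eq_of_card_lt_of_maps_to
    (s := Finset.univ) (t := T.edgeFinset) (f := fun t => s(t, d t))
    (by rw [Finset.card_univ]; omega) (by
      intro t _
      simpa using hd t)
  rcases Sym2.eq_iff.1 heq with ⟨h, -⟩ | ⟨h1, h2⟩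
  · exact hne h
  · obtain ⟨x, hx, hx'⟩ := hmeet (a t) (a t')
    obtain ⟨s, hs⟩ := D.exists_mem_bag x
    have h3 := hside t x hx s hs
    have h4 := hside t' x hx' s hs
    rw [h2] at h3
    rw [← h1] at h4
    have : T.Adj t t' := h2 ▸ hd t
    exact Set.disjoint_left.1 (disjoint_treeSide D.isAcyclic this) h3 h4

end TreeDecomposition

/-! ### Monotonicity under minors -/

/-- A linear functional that vanishes on the kernel of `L` is a combination of the coordinates
of `L`. -/
theorem exists_coeff_of_ker_le {V E : Type*} [Fintype E] [DecidableEq E] [AddCommGroup V]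
    [Module (ZMod 2) V] (L : V →ₗ[ZMod 2] (E → ZMod 2)) (l : V →ₗ[ZMod 2] ZMod 2)
    (h : ∀ φ, L φ = 0 → l φ = 0) : ∃ x : E → ZMod 2, ∀ φ, l φ = ∑ e, L φ e * x e := by
  have hl : l ∈ LinearMap.range L.dualMap := by
    rw [LinearMap.range_dualMap_eq_dualAnnihilator_ker, Submodule.mem_dualAnnihilator]
    exact fun φ hφ => h φ hφ
  obtain ⟨μ, rfl⟩ := hl
  exact ⟨fun e => μ fun j => if e = j then 1 else 0, fun φ =>
    LinearMap.pi_apply_eq_sum_univ μ (L φ)⟩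

/-- Restricting a pair of nested subspaces to a kernel, and then mapping it forward, does not
increase the codimension. -/
theorem finrank_map_inf_le {M N : Type*} [AddCommGroup M] [Module (ZMod 2) M] [AddCommGroup N]
    [Module (ZMod 2) N] [FiniteDimensional (ZMod 2) M] {B Z U : Submodule (ZMod 2) M} (hBZ : B ≤ Z)
    (π : M →ₗ[ZMod 2] N) {g : ℕ} (h : finrank (ZMod 2) Z ≤ finrank (ZMod 2) B + g) :
    finrank (ZMod 2) ((Z ⊓ U).map π) ≤ finrank (ZMod 2) ((B ⊓ U).map π) + g := by
  have h1 := finrank_map_add_finrank_inf_ker (Z ⊓ U) π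
  have h2 := finrank_map_add_finrank_inf_ker (B ⊓ U) π
  have h3 : finrank (ZMod 2) (B ⊓ U ⊓ LinearMap.ker π : Submodule (ZMod 2) M) ≤
      finrank (ZMod 2) (Z ⊓ U ⊓ LinearMap.ker π : Submodule (ZMod 2) M) :=
    Submodule.finrank_mono (inf_le_inf_right _ (inf_le_inf_right _ hBZ))
  have h4 := Submodule.finrank_sup_add_finrank_inf_eq B (Z ⊓ U)
  have h5 : B ⊓ (Z ⊓ U) = B ⊓ U := by rw [← inf_assoc, inf_eq_left.2 hBZ]
  have h6 : finrank (ZMod 2) (B ⊔ Z ⊓ U : Submodule (ZMod 2) M) ≤ finrank (ZMod 2) Z :=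
    Submodule.finrank_mono (sup_le hBZ inf_le_left)
  rw [h5] at h4
  omega

/-- Given a minor model of `H` in `G`, pick an edge of `G` for every edge of `H`. Consider the cycles
of `G` that use only these edges and edges inside the branch sets. Forgetting the latter maps these
cycles onto the cycle space of `H`; that every cycle of `H` lifts is a consequence of the
connectedness of the branch sets, by duality. -/
theorem SparseGenusLE.of_isMinor {V W : Type*} [Fintype V] [DecidableEq V] [Fintype W]
    [DecidableEq W] {G : SimpleGraph V} {H : SimpleGraph W} {g : ℕ} (hG : SparseGenusLE G g)
    (hHG : IsMinor H G) : SparseGenusLE H g := by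
  classical
  obtain ⟨X, hconn, hdisj, hadj⟩ := hHG
  obtain ⟨B, hBZ, hB, hcodim⟩ := hG
  have huniq : ∀ {w w' v}, v ∈ X w → v ∈ X w' → w = w' := by
    intro w w' v h h'
    by_contra hne
    exact Set.disjoint_left.1 (hdisj w w' hne) h h'
  -- the edge of `G` chosen for an edge of `H`; a non-edge of `H` is sent to a diagonal pair, where
  -- all edge vectors vanish
  have hch : ∀ e : Sym2 W, ∃ e' : Sym2 V,
      (e ∈ H.edgeSet → ∃ w w' x y, e = s(w, w') ∧ x ∈ X w ∧ y ∈ X w' ∧ G.Adj x y ∧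
        e' = s(x, y)) ∧ (e ∉ H.edgeSet → e' ∉ G.edgeSet) := by
    intro e
    induction e with
    | h w w' =>
      by_cases he : H.Adj w w'
      · obtain ⟨x, hx, y, hy, hxy⟩ := hadj w w' he
        exact ⟨s(x, y), fun _ => ⟨w, w', x, y, rfl, hx, hy, hxy, rfl⟩, fun h => absurd he h⟩
      · obtain ⟨x, -⟩ := (hconn w).nonempty
        exact ⟨s(x, x), fun h => absurd h he, fun _ => G.loopless.irrefl x⟩
  choose ch hch1 hch2 using hch
  let inner : Set (Sym2 V) := {e | e ∈ G.edgeSet ∧ ∃ w, ∀ v ∈ e, v ∈ X w}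
  have hch_inner : ∀ e ∈ H.edgeSet, ch e ∉ inner := by
    rintro e he ⟨-, w, hw⟩
    obtain ⟨w₁, w₂, x, y, rfl, hx, hy, -, hc⟩ := hch1 e he
    rw [hc] at hw
    have h1 := huniq hx (hw x (by simp))
    have h2 := huniq hy (hw y (by simp))
    exact H.ne_of_adj he (h1.trans h2.symm)
  have hch_inj : ∀ e ∈ H.edgeSet, ∀ e' ∈ H.edgeSet, ch e = ch e' → e = e' := by
    intro e he e' he' h
    obtain ⟨w₁, w₂, x, y, rfl, hx, hy, -, hc⟩ := hch1 e he
    obtain ⟨w₁', w₂', x', y', rfl, hx', hy', -, hc'⟩ := hch1 e' he'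
    rw [hc, hc'] at h
    rcases Sym2.eq_iff.1 h with ⟨rfl, rfl⟩ | ⟨rfl, rfl⟩
    · rw [huniq hx hx', huniq hy hy']
    · rw [huniq hx hy', huniq hy hx', Sym2.eq_swap]
  -- vertex functions of `G` that are constant on the branch sets correspond to those of `H`
  have hpull : ∀ (φ : V → ZMod 2) (ψ : W → ZMod 2), (∀ w, ∀ v ∈ X w, φ v = ψ w) →
      ∀ e ∈ H.edgeSet, coboundary φ (ch e) = coboundary ψ e := by
    intro φ ψ hφ e he
    obtain ⟨w, w', x, y, rfl, hx, hy, -, hc⟩ := hch1 e he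
    rw [hc, coboundary_mk, coboundary_mk, hφ w x hx, hφ w' y hy]
  let U : Submodule (ZMod 2) (Sym2 V → ZMod 2) := vanishOn {e | e ∉ inner ∧ e ∉ ch '' H.edgeSet}
  let π := LinearMap.funLeft (ZMod 2) (ZMod 2) ch
  have hsum : ∀ z : Sym2 V → ZMod 2, z ∈ U → ∀ (φ : V → ZMod 2) (ψ : W → ZMod 2),
      (∀ w, ∀ v ∈ X w, φ v = ψ w) → ∑ e, coboundary φ e * z e =
        ∑ e ∈ Finset.univ.filter (· ∈ H.edgeSet), coboundary ψ e * z (ch e) := by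
    intro z hz φ ψ hφ
    have h1 : ∑ e ∈ Finset.univ.filter (· ∈ H.edgeSet), coboundary ψ e * z (ch e) =
        ∑ e ∈ Finset.univ.filter (· ∈ H.edgeSet), coboundary φ (ch e) * z (ch e) :=
      Finset.sum_congr rfl fun e he => by rw [hpull φ ψ hφ e (Finset.mem_filter.1 he).2]
    rw [h1, ← Finset.sum_image (f := fun e => coboundary φ e * z e) (g := ch)
      (s := Finset.univ.filter (· ∈ H.edgeSet)) fun e he e' he' =>
        hch_inj e (by simpa using he) e' (by simpa using he')]
    refine (Finset.sum_subset (Finset.subset_univ _) fun e _ he => ?_).symm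
    by_cases hin : e ∈ inner
    · obtain ⟨-, w, hw⟩ := hin
      induction e with
      | h x y =>
        rw [coboundary_mk, hφ w x (hw x (by simp)), hφ w y (hw y (by simp)),
          zmod_two_add_eq_zero.2 rfl, zero_mul]
    · rw [hz e ⟨hin, fun h => he (by simpa using h)⟩, mul_zero]
  have hHsum : ∀ (y : Sym2 W → ZMod 2) (ψ : W → ZMod 2), (∀ e ∉ H.edgeSet, y e = 0) →
      ∑ e, coboundary ψ e * y e =
        ∑ e ∈ Finset.univ.filter (· ∈ H.edgeSet), coboundary ψ e * y e := by
    intro y ψ hy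
    refine (Finset.sum_subset (Finset.subset_univ _) fun e _ he => ?_).symm
    rw [hy e fun h => he (by simpa using h), mul_zero]
  have hmaps : ∀ z ∈ cycleSpace G ⊓ U, π z ∈ cycleSpace H := by
    rintro z ⟨hz, hzU⟩
    have hsupp : ∀ e ∉ H.edgeSet, π z e = 0 := fun e he => hz.1 _ (hch2 e he)
    refine ⟨hsupp, fun ψ => ?_⟩
    let φ : V → ZMod 2 := fun v => if h : ∃ w, v ∈ X w then ψ h.choose else 0
    have hφ : ∀ w, ∀ v ∈ X w, φ v = ψ w := by
      intro w v hv
      have h : ∃ w, v ∈ X w := ⟨w, hv⟩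
      exact (dif_pos h).trans (congrArg ψ (huniq h.choose_spec hv))
    rw [hHsum _ ψ hsupp]
    exact (hsum z hzU φ ψ hφ).symm.trans (hz.2 φ)
  have hlift : cycleSpace H ≤ (cycleSpace G ⊓ U).map π := by
    intro y hy
    -- the inner edges have to cancel the boundary of the chosen edges
    let L : (V → ZMod 2) →ₗ[ZMod 2] (Sym2 V → ZMod 2) :=
      { toFun := fun φ e => if e ∈ inner then coboundary φ e else 0
        map_add' := fun a b => by
          ext e
          induction e with
          | h u v =>
            by_cases h : s(u, v) ∈ inner
            · simp only [h, if_true, Pi.add_apply, coboundary_mk]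
              ring
            · simp [h]
        map_smul' := fun r a => by
          ext e
          induction e with
          | h u v =>
            by_cases h : s(u, v) ∈ inner
            · simp only [h, if_true, Pi.smul_apply, coboundary_mk, smul_eq_mul, RingHom.id_apply]
              ring
            · simp [h] }
    let l : (V → ZMod 2) →ₗ[ZMod 2] ZMod 2 :=
      { toFun := fun φ => ∑ e ∈ Finset.univ.filter (· ∈ H.edgeSet), coboundary φ (ch e) * y e
        map_add' := fun a b => by
          rw [← Finset.sum_add_distrib]
          refine Finset.sum_congr rfl fun e _ => ?_
          induction ch e with
          | h u v =>
            simp only [Pi.add_apply, coboundary_mk]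
            ring
        map_smul' := fun r a => by
          rw [RingHom.id_apply, smul_eq_mul, Finset.mul_sum]
          refine Finset.sum_congr rfl fun e _ => ?_
          induction ch e with
          | h u v =>
            simp only [Pi.smul_apply, smul_eq_mul, coboundary_mk]
            ring }
    obtain ⟨x, hx⟩ := exists_coeff_of_ker_le L l (by
      intro φ hφ
      have hφw : ∀ w, ∀ v ∈ X w, φ v = φ (hconn w).nonempty.some := by
        intro w
        refine connected_induction (hconn w) (hconn w).nonempty.some.2 rfl
          fun u hu v hv huv h => ?_
        have h1 : L φ s(u, v) = coboundary φ s(u, v) :=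
          if_pos ⟨huv, w, by simp [hu, hv]⟩
        rw [hφ] at h1
        rw [← h]
        exact (zmod_two_add_eq_zero.1 h1.symm).symm
      have h2 := hy.2 fun w => φ (hconn w).nonempty.some
      rw [hHsum y _ hy.1] at h2
      rw [← h2]
      refine Finset.sum_congr rfl fun e he => ?_
      rw [hpull φ _ hφw e (Finset.mem_filter.1 he).2])
    let z : Sym2 V → ZMod 2 := fun e => if e ∈ inner then x e else
      ∑ e' ∈ Finset.univ.filter (· ∈ H.edgeSet), if ch e' = e then y e' else 0
    have hzch : ∀ e ∈ H.edgeSet, z (ch e) = y e := by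
      intro e he
      refine (if_neg (hch_inner e he)).trans ?_
      rw [Finset.sum_eq_single e (fun e' he' hne => if_neg fun h =>
        hne (hch_inj e' (by simpa using he') e he h)) fun h => absurd (by simpa using he) h, if_pos rfl]
    have hzU : z ∈ U := by
      rintro e ⟨h1, h2⟩
      refine (if_neg h1).trans (Finset.sum_eq_zero fun e' he' => if_neg ?_)
      rintro rfl
      exact h2 ⟨e', by simpa using he', rfl⟩
    refine ⟨z, ⟨⟨fun e he => ?_, fun φ => ?_⟩, hzU⟩, funext fun e => ?_⟩
    · refine hzU e ⟨fun h => he h.1, ?_⟩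
      rintro ⟨e', he', rfl⟩
      obtain ⟨w, w', x, y, -, -, -, hxy, hc⟩ := hch1 e' he'
      rw [hc] at he
      exact he hxy
    · have h1 : ∑ e, coboundary φ e * z e = ∑ e, L φ e * x e + l φ := by
        have h2 : ∀ e, coboundary φ e * z e = L φ e * x e +
            ∑ e' ∈ Finset.univ.filter (· ∈ H.edgeSet),
              if ch e' = e then coboundary φ (ch e') * y e' else 0 := by
          intro e
          by_cases he : e ∈ inner
          · rw [Finset.sum_eq_zero, add_zero]
            · simp [z, L, he]
            · intro e' he'
              refine if_neg ?_
              rintro rfl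
              exact hch_inner e' (by simpa using he') he
          · simp only [z, L, he, if_false, LinearMap.coe_mk, AddHom.coe_mk, zero_mul, zero_add,
              Finset.mul_sum]
            refine Finset.sum_congr rfl fun e' _ => ?_
            split_ifs with h
            · rw [h]
            · rw [mul_zero]
        rw [Finset.sum_congr rfl fun e _ => h2 e, Finset.sum_add_distrib, Finset.sum_comm]
        congr 1
        exact Finset.sum_congr rfl fun e' _ => by simp
      rw [h1, hx φ, zmod_two_add_eq_zero]
    · by_cases he : e ∈ H.edgeSet
      · exact hzch e he
      · rw [hy.1 e he]
        refine hzU _ ⟨fun h => hch2 e he h.1, ?_⟩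
        rintro ⟨e', he', h⟩
        obtain ⟨w, w', x, y, -, -, -, hxy, hc⟩ := hch1 e' he'
        refine hch2 e he ?_
        rw [← h, hc]
        exact hxy
  refine ⟨(B ⊓ U).map π, ?_, (hB.inf_vanishOn _).map_funLeft _, ?_⟩
  · rintro _ ⟨z, hz, rfl⟩
    exact hmaps z ⟨hBZ hz.1, hz.2⟩
  · exact (Submodule.finrank_mono hlift).trans (finrank_map_inf_le hBZ π hcodim)

/-! ### Disjoint copies of the complete graph on five vertices -/

/-- The disjoint union of `n` copies of the complete graph on five vertices. -/
def copiesK5 (n : ℕ) : SimpleGraph (Fin n × Fin 5) where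
  Adj a b := a.1 = b.1 ∧ a.2 ≠ b.2
  symm := ⟨fun _ _ h => ⟨h.1.symm, h.2.symm⟩⟩
  loopless := ⟨fun _ h => h.2 rfl⟩

/-- A cycle that uses an edge `ab` uses another edge at `a`. -/
theorem exists_ne_of_mem_cycleSpace {V : Type*} [Fintype V] [DecidableEq V] {G : SimpleGraph V}
    {z : Sym2 V → ZMod 2} (hz : z ∈ cycleSpace G) {a b : V} (h : z s(a, b) ≠ 0) :
    ∃ c, c ≠ b ∧ z s(a, c) ≠ 0 := by
  by_contra! hcon
  have hab : a ≠ b := by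
    rintro rfl
    exact h (hz.1 _ (G.loopless.irrefl a))
  have h1 := hz.2 (Pi.single a 1)
  rw [Finset.sum_eq_single s(a, b)] at h1
  · rw [coboundary_mk, Pi.single_eq_same, Pi.single_eq_of_ne hab.symm, add_zero, one_mul] at h1
    exact h h1
  · intro e _ he
    induction e with
    | h u v =>
      by_cases hu : u = a
      · subst hu
        rw [hcon v (fun hv => he (by rw [hv])), mul_zero]
      · by_cases hv : v = a
        · subst hv
          rw [Sym2.eq_swap, hcon u (fun hu => he (by rw [hu, Sym2.eq_swap])), mul_zero]
        · rw [coboundary_mk, Pi.single_eq_of_ne hu, Pi.single_eq_of_ne hv, add_zero, zero_mul]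
  · exact fun h => absurd (Finset.mem_univ _) h

/-- A triangle is a cycle. -/
theorem triangle_mem_cycleSpace {V : Type*} [Fintype V] [DecidableEq V] {G : SimpleGraph V}
    {a b c : V} (hab : G.Adj a b) (hbc : G.Adj b c) (hac : G.Adj a c) :
    (Pi.single s(a, b) 1 + Pi.single s(b, c) 1 + Pi.single s(a, c) 1 : Sym2 V → ZMod 2) ∈
      cycleSpace G := by
  refine ⟨fun e he => ?_, fun φ => ?_⟩
  · have h : ∀ u v, G.Adj u v → e ≠ s(u, v) := by
      rintro u v huv rfl
      exact he huv
    simp [Pi.single_eq_of_ne (h _ _ hab), Pi.single_eq_of_ne (h _ _ hbc),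
      Pi.single_eq_of_ne (h _ _ hac)]
  · simp only [Pi.add_apply, mul_add, Finset.sum_add_distrib, Pi.single_apply, mul_ite, mul_one,
      mul_zero, Finset.sum_ite_eq', Finset.mem_univ, if_true, coboundary_mk]
    generalize φ a = p
    generalize φ b = q
    generalize φ c = r
    revert p q r
    decide

/-- The complete graph on five vertices is not planar: its two-sparse spaces of cycles have
dimension at most `5`, while the cycle space has dimension `6`. -/
theorem finrank_le_five_of_isTwoSparse (C : Submodule (ZMod 2) (Sym2 (Fin 5) → ZMod 2))
    (hC : C ≤ cycleSpace ⊤) (h : IsTwoSparse C) : finrank (ZMod 2) C ≤ 5 := by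
  by_contra hcon
  have hS : (Finset.univ.filter fun e : Sym2 (Fin 5) => ¬ e.IsDiag).card = 10 := by decide
  have key := h.mul_finrank_succ_le (Finset.univ.filter fun e : Sym2 (Fin 5) => ¬ e.IsDiag) 3 (by
    intro b hb hb0
    have hb := hC hb
    have hdiag : ∀ u v, b s(u, v) ≠ 0 → u ≠ v := by
      rintro u v h rfl
      exact h (hb.1 _ (by simp))
    obtain ⟨e, he⟩ := Function.ne_iff.1 hb0
    induction e with
    | h u v =>
      have huv : b s(u, v) ≠ 0 := he
      obtain ⟨c, hcv, hc⟩ := exists_ne_of_mem_cycleSpace hb huv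
      obtain ⟨d, hdu, hd⟩ := exists_ne_of_mem_cycleSpace hb (a := v) (b := u)
        (by rwa [Sym2.eq_swap])
      have hne := hdiag u v huv
      have hne1 := hdiag u c hc
      have hne2 := hdiag v d hd
      have hcard : ({s(u, v), s(u, c), s(v, d)} : Finset (Sym2 (Fin 5))).card = 3 := by
        refine Finset.card_eq_three.2 ⟨_, _, _, ?_, ?_, ?_, rfl⟩
        · simp [hcv.symm, hne1]
        · simp [hne, hdu.symm]
        · simp [hne, hdu.symm]
      rw [← hcard]
      refine Finset.card_le_card fun e he => ?_
      simp only [Finset.mem_insert, Finset.mem_singleton] at he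
      rcases he with rfl | rfl | rfl
      · simpa [hne] using huv
      · simpa [hne1] using hc
      · simpa [hne2] using hd) (by omega)
  rw [hS] at key
  omega

/-- The triangles through the last vertex of each copy are linearly independent. -/
theorem mul_six_le_finrank_cycleSpace_copiesK5 (n : ℕ) :
    n * 6 ≤ finrank (ZMod 2) (cycleSpace (copiesK5 n)) := by
  let P := {p : Fin 4 × Fin 4 // p.1 < p.2}
  let a : Fin n × P → Fin n × Fin 5 := fun x => (x.1, x.2.1.1.castSucc)
  let b : Fin n × P → Fin n × Fin 5 := fun x => (x.1, x.2.1.2.castSucc)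
  let c : Fin n × P → Fin n × Fin 5 := fun x => (x.1, Fin.last 4)
  have hab : ∀ x, (copiesK5 n).Adj (a x) (b x) := fun x =>
    ⟨rfl, fun h => x.2.2.ne (Fin.castSucc_injective _ h)⟩
  have hbc : ∀ x, (copiesK5 n).Adj (b x) (c x) := fun x => ⟨rfl, (Fin.castSucc_lt_last _).ne⟩
  have hac : ∀ x, (copiesK5 n).Adj (a x) (c x) := fun x => ⟨rfl, (Fin.castSucc_lt_last _).ne⟩
  let v : Fin n × P → cycleSpace (copiesK5 n) := fun x =>
    ⟨_, triangle_mem_cycleSpace (hab x) (hbc x) (hac x)⟩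
  have hval : ∀ x y, (v x : Sym2 (Fin n × Fin 5) → ZMod 2) s(a y, b y) = if x = y then 1 else 0 := by
    intro x y
    have h1 : s(a y, b y) ≠ s(b x, c x) := by
      intro h
      have : c x ∈ s(a y, b y) := h ▸ Sym2.mem_mk_right _ _
      rcases Sym2.mem_iff.1 this with h | h
      · exact (Fin.castSucc_lt_last _).ne (congrArg Prod.snd h).symm
      · exact (Fin.castSucc_lt_last _).ne (congrArg Prod.snd h).symm
    have h2 : s(a y, b y) ≠ s(a x, c x) := by
      intro h
      have : c x ∈ s(a y, b y) := h ▸ Sym2.mem_mk_right _ _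
      rcases Sym2.mem_iff.1 this with h | h
      · exact (Fin.castSucc_lt_last _).ne (congrArg Prod.snd h).symm
      · exact (Fin.castSucc_lt_last _).ne (congrArg Prod.snd h).symm
    have h3 : s(a y, b y) = s(a x, b x) ↔ x = y := by
      refine ⟨fun h => ?_, fun h => by rw [h]⟩
      rcases Sym2.eq_iff.1 h with ⟨h, h'⟩ | ⟨h, h'⟩
      · have e1 := congrArg Prod.fst h
        have e2 := Fin.castSucc_injective _ (congrArg Prod.snd h)
        have e3 := Fin.castSucc_injective _ (congrArg Prod.snd h')
        have e4 : y.2 = x.2 := Subtype.ext (Prod.ext e2 e3)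
        have e5 : y = x := Prod.ext e1 e4
        exact e5.symm
      · have e2 := Fin.castSucc_injective _ (congrArg Prod.snd h)
        have e3 := Fin.castSucc_injective _ (congrArg Prod.snd h')
        have l1 := x.2.2
        have l2 := y.2.2
        rw [e2, e3] at l2
        exact absurd l2 l1.asymm
    simp only [v, Pi.add_apply, Pi.single_eq_of_ne h1, Pi.single_eq_of_ne h2, add_zero,
      Pi.single_apply, h3]
  have hli : LinearIndependent (ZMod 2) v := by
    rw [Fintype.linearIndependent_iff]
    intro r hr y
    have h1 := congrFun (congrArg Subtype.val hr) s(a y, b y)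
    simpa [hval] using h1
  have h := hli.fintype_card_le_finrank
  have hP : Fintype.card P = 6 := by decide
  rwa [Fintype.card_prod, Fintype.card_fin, hP] at h

/-- The sparse genus of `n` disjoint complete graphs on five vertices is at least `n`. -/
theorem SparseGenusLE.le_of_copiesK5 {n g : ℕ} (h : SparseGenusLE (copiesK5 n) g) : n ≤ g := by
  obtain ⟨B, hBZ, hB, hcodim⟩ := h
  let r : Fin n × Sym2 (Fin 5) → Sym2 (Fin n × Fin 5) := fun x => x.2.map fun a => (x.1, a)
  have hr : ∀ i u v, r (i, s(u, v)) = s((i, u), (i, v)) := fun _ _ _ => rfl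
  let π := LinearMap.funLeft (ZMod 2) (ZMod 2) r
  have hsurj : ∀ e ∈ (copiesK5 n).edgeSet, ∃ x, r x = e := by
    intro e he
    induction e with
    | h u v =>
      obtain ⟨i, u⟩ := u
      obtain ⟨j, v⟩ := v
      obtain rfl : i = j := he.1
      exact ⟨(i, s(u, v)), rfl⟩
  have h1 : finrank (ZMod 2) (B.map π) = finrank (ZMod 2) B := by
    have h2 := finrank_map_add_finrank_inf_ker B π
    have h3 : B ⊓ LinearMap.ker π = ⊥ := by
      refine (Submodule.eq_bot_iff _).2 ?_
      rintro b ⟨hb, hker⟩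
      ext e
      by_cases he : e ∈ (copiesK5 n).edgeSet
      · obtain ⟨x, rfl⟩ := hsurj e he
        exact congrFun hker x
      · exact (hBZ hb).1 e he
    rwa [h3, finrank_bot, add_zero] at h2
  have h2 := IsTwoSparse.finrank_le_mul (cycleSpace (⊤ : SimpleGraph (Fin 5))) 5
    finrank_le_five_of_isTwoSparse n (B.map π) (hB.map_funLeft _) (by
      rintro _ ⟨b, hb, rfl⟩ i
      have hb := hBZ hb
      refine ⟨fun e he => ?_, fun φ => ?_⟩
      · refine hb.1 _ ?_
        induction e with
        | h u v => exact fun h => he h.2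
      · have h3 := hb.2 fun x => if x.1 = i then φ x.2 else 0
        have hinj : Function.Injective fun e => r (i, e) :=
          Sym2.map.injective (f := fun a : Fin 5 => (i, a)) fun a b h => congrArg Prod.snd h
        rw [← Finset.sum_subset (Finset.subset_univ (Finset.univ.image fun e => r (i, e))),
          Finset.sum_image fun e _ e' _ h => hinj h] at h3
        · rw [← h3]
          refine Finset.sum_congr rfl fun e _ => ?_
          induction e with
          | h u v => simp [hr, π, LinearMap.funLeft_apply]
        · intro e _ he
          by_cases hmem : e ∈ (copiesK5 n).edgeSet
          · obtain ⟨⟨j, e⟩, rfl⟩ := hsurj e hmem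
            have hj : j ≠ i := by
              rintro rfl
              exact he (Finset.mem_image_of_mem (fun e => r (j, e)) (Finset.mem_univ e))
            induction e with
            | h u v => simp [hr, hj]
          · rw [hb.1 e hmem, mul_zero])
  have h3 := mul_six_le_finrank_cycleSpace_copiesK5 n
  omega

theorem EulerGenusLE.le_of_isMinor_copiesK5 {V : Type*} [Finite V] {G : SimpleGraph V} {n g : ℕ}
    (hG : EulerGenusLE G g) (h : IsMinor (copiesK5 n) G) : n ≤ g := by
  classical
  have := Fintype.ofFinite V
  exact (hG.sparseGenusLE.of_isMinor h).le_of_copiesK5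

/-! ### Near-embeddable torsos -/

theorem connected_induce_induce {V : Type*} {G : SimpleGraph V} {X S : Set V}
    (hX : (G.induce X).Connected) (hXS : X ⊆ S) :
    ((G.induce S).induce {v : S | (v : V) ∈ X}).Connected := by
  obtain ⟨x, hx⟩ := hX.nonempty
  refine connected_of_induction (x := ⟨x, hXS hx⟩) hx fun P hP hstep => ?_
  have key := connected_induction hX (P := fun v => ∀ h : v ∈ S, P ⟨v, h⟩) hx (fun _ => hP)
    fun u hu v hv huv h hvS => hstep ⟨u, hXS hu⟩ hu ⟨v, hvS⟩ hv huv (h _)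
  exact fun y hy => key y hy y.2

/-- A graph that has at most `k` vertices or is embeddable with Euler genus `k` after deleting `k`
apices has no `2 * k + 1` disjoint minors that are complete graphs on five vertices: the apices can
destroy only `k` of them. -/
theorem not_isMinor_copiesK5 {V : Type*} [Finite V] {G : SimpleGraph V} {k : ℕ}
    (hG : k < Nat.card V → ∃ A : Set V, A.ncard ≤ k ∧ EulerGenusLE (G.induce Aᶜ) k) :
    ¬ IsMinor (copiesK5 (2 * k + 1)) G := by
  rintro ⟨X, hconn, hdisj, hadj⟩
  have huniq : ∀ {w w' v}, v ∈ X w → v ∈ X w' → w = w' := by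
    intro w w' v h h'
    by_contra hne
    exact Set.disjoint_left.1 (hdisj w w' hne) h h'
  have hcard : k < Nat.card V := by
    have := Nat.card_le_card_of_injective (fun w => ((hconn w).nonempty.some : V)) fun w w' h =>
      huniq (hconn w).nonempty.some.2 (by
        have h' : ((hconn w).nonempty.some : V) = (hconn w').nonempty.some := h
        rw [h']
        exact (hconn w').nonempty.some.2)
    simp only [Nat.card_prod, Nat.card_fin] at this
    omega
  obtain ⟨A, hA, hgenus⟩ := hG hcard
  let bad : Set (Fin (2 * k + 1)) := {i | ∃ j, ∃ v ∈ X (i, j), v ∈ A}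
  have hbad : bad.ncard ≤ k := by
    choose j v hv hvA using fun i : bad => i.2
    rw [← Nat.card_coe_set_eq]
    refine le_trans (Nat.card_le_card_of_injective (fun i => (⟨v i, hvA i⟩ : A)) ?_) hA
    intro i i' h
    have h1 := hv i
    have h2 : v i = v i' := congrArg (fun v : A => (v : V)) h
    rw [h2] at h1
    exact Subtype.ext (congrArg Prod.fst (huniq h1 (hv i')))
  have hgood : k + 1 ≤ Nat.card (badᶜ : Set (Fin (2 * k + 1))) := by
    have := Set.ncard_add_ncard_compl bad
    rw [Nat.card_fin] at this
    rw [Nat.card_coe_set_eq]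
    omega
  obtain ⟨φ⟩ : Nonempty (Fin (k + 1) ↪ (badᶜ : Set (Fin (2 * k + 1)))) := by
    classical
    refine Function.Embedding.nonempty_of_card_le ?_
    rwa [Fintype.card_fin, ← Nat.card_eq_fintype_card]
  have hav : ∀ (i : Fin (k + 1)) j, X (φ i, j) ⊆ Aᶜ := fun i j v hv hvA => (φ i).2 ⟨j, v, hv, hvA⟩
  have hle := hgenus.le_of_isMinor_copiesK5 (n := k + 1) (by
    refine ⟨fun w => {v | (v : V) ∈ X (φ w.1, w.2)}, fun w =>
      connected_induce_induce (hconn _) (hav _ _), fun w w' hne => ?_, fun w w' h => ?_⟩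
    · refine Set.disjoint_left.2 fun v hv hv' => hne ?_
      have h := huniq hv hv'
      have h1 : φ w.1 = φ w'.1 := Subtype.ext (congrArg Prod.fst h)
      have h2 : w.2 = w'.2 := (Prod.mk.inj h).2
      exact Prod.ext (φ.injective h1) h2
    · obtain ⟨x, hx, y, hy, hxy⟩ := hadj (φ w.1, w.2) (φ w'.1, w'.2)
        ⟨congrArg (fun i => (φ i : Fin (2 * k + 1))) h.1, h.2⟩
      exact ⟨⟨x, hav _ _ hx⟩, hx, ⟨y, hav _ _ hy⟩, hy, hxy⟩)
  omega

/-- Adhesion sets are cliques in the torso, so they are small if the torso has few disjoint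
complete minors. -/
theorem TreeDecomposition.ncard_adhesion_le {V ι : Type*} [Finite V] {G : SimpleGraph V}
    {T : SimpleGraph ι} (D : TreeDecomposition G T) {t d : ι} (hd : T.Adj t d) {n : ℕ}
    (h : ¬ IsMinor (copiesK5 n) (D.torso t)) : (D.bag t ∩ D.bag d).ncard < n * 5 := by
  by_contra! hcon
  refine h ?_
  classical
  have := Fintype.ofFinite V
  obtain ⟨φ⟩ : Nonempty (Fin n × Fin 5 ↪ (D.bag t ∩ D.bag d : Set V)) := by
    refine Function.Embedding.nonempty_of_card_le ?_
    rwa [Fintype.card_prod, Fintype.card_fin, Fintype.card_fin, ← Nat.card_eq_fintype_card,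
      Nat.card_coe_set_eq]
  let ψ : Fin n × Fin 5 → D.bag t := fun w => ⟨φ w, (φ w).2.1⟩
  have hψ : ∀ w w', ψ w = ψ w' → w = w' := fun w w' h => by
    have h' : (φ w : V) = φ w' := congrArg (fun v : D.bag t => (v : V)) h
    exact φ.injective (Subtype.ext h')
  refine ⟨fun w => {ψ w}, fun w => ?_, fun w w' hne => ?_, fun w w' hww' => ?_⟩
  · refine connected_of_induction (x := ψ w) rfl fun P hP _ y hy => ?_
    rw [Set.mem_singleton_iff.1 hy]
    exact hP
  · exact Set.disjoint_singleton.2 fun h => hne (hψ w w' h)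
  · exact ⟨_, rfl, _, rfl, fun h => hww'.ne (hψ w w' h), Or.inr ⟨d, hd, (φ w).2.2, (φ w').2.2⟩⟩

/-! ### Rectangles in the shallow vortex grid -/

/-- The rectangle of the rows `r₁ ≤ r < r₂` and columns `c₁ ≤ c < c₂`. -/
def rect (K r₁ r₂ c₁ c₂ : ℕ) : Set (Fin K × Fin (2 * K)) :=
  {w | r₁ ≤ (w.1 : ℕ) ∧ (w.1 : ℕ) < r₂ ∧ c₁ ≤ (w.2 : ℕ) ∧ (w.2 : ℕ) < c₂}

theorem adj_next_column {K r c : ℕ} (hr : r < K) (hc : c + 1 < 2 * K) :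
    (shallowVortexGrid K).Adj (⟨r, hr⟩, ⟨c, by omega⟩) (⟨r, hr⟩, ⟨c + 1, hc⟩) := by
  refine (SimpleGraph.fromRel_adj _ _ _).2 ⟨by simp, Or.inl (Or.inl ⟨rfl, ?_⟩)⟩
  exact (Nat.mod_eq_of_lt hc).symm

theorem adj_next_row {K r c : ℕ} (hr : r + 1 < K) (hc : c < 2 * K) :
    (shallowVortexGrid K).Adj (⟨r, by omega⟩, ⟨c, hc⟩) (⟨r + 1, hr⟩, ⟨c, hc⟩) :=
  (SimpleGraph.fromRel_adj _ _ _).2 ⟨by simp, Or.inl (Or.inr (Or.inl ⟨rfl, rfl⟩))⟩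

theorem adj_skip_column {K c : ℕ} (hK : 0 < K) (hc : c + 2 < 2 * K) :
    (shallowVortexGrid K).Adj (⟨0, hK⟩, ⟨c, by omega⟩) (⟨0, hK⟩, ⟨c + 2, hc⟩) := by
  refine (SimpleGraph.fromRel_adj _ _ _).2 ⟨by simp, Or.inl (Or.inr (Or.inr ⟨rfl, rfl, ?_⟩))⟩
  exact (Nat.mod_eq_of_lt hc).symm

theorem connected_rect {K r₁ r₂ c₁ c₂ : ℕ} (hr : r₁ < r₂) (hr₂ : r₂ ≤ K) (hc : c₁ < c₂)
    (hc₂ : c₂ ≤ 2 * K) : ((shallowVortexGrid K).induce (rect K r₁ r₂ c₁ c₂)).Connected := by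
  refine connected_of_induction (x := (⟨r₁, by omega⟩, ⟨c₁, by omega⟩))
    ⟨le_rfl, hr, le_rfl, hc⟩ fun P hP hstep => ?_
  have hcol : ∀ n (hn : r₁ + n < r₂), P (⟨r₁ + n, by omega⟩, ⟨c₁, by omega⟩) := by
    intro n
    induction n with
    | zero => exact fun _ => hP
    | succ n ih =>
      intro hn
      refine hstep _ ?_ _ ?_ (adj_next_row (r := r₁ + n) (by omega) (by omega)) (ih (by omega))
      · exact ⟨by simp, by simp only; omega, le_rfl, hc⟩
      · exact ⟨by simp, by simp; omega, le_rfl, hc⟩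
  have hrow : ∀ n (hn : r₁ + n < r₂) m (hm : c₁ + m < c₂),
      P (⟨r₁ + n, by omega⟩, ⟨c₁ + m, by omega⟩) := by
    intro n hn m
    induction m with
    | zero => exact fun _ => hcol n hn
    | succ m ih =>
      intro hm
      refine hstep _ ?_ _ ?_ (adj_next_column (c := c₁ + m) (by omega) (by omega)) (ih (by omega))
      · exact ⟨by simp, hn, by simp, by simp; omega⟩
      · exact ⟨by simp, hn, by simp, by simp; omega⟩
  rintro ⟨⟨r, hrK⟩, ⟨c, hcK⟩⟩ ⟨h1, h2, h3, h4⟩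
  obtain ⟨n, rfl⟩ := Nat.exists_eq_add_of_le h1
  obtain ⟨m, rfl⟩ := Nat.exists_eq_add_of_le h3
  exact hrow n h2 m h4

/-- Branch sets of a complete graph on five vertices in the six columns of the shallow vortex grid
that start at column `c`. The columns `c + 1, …, c + 4`, up to height `h`, are the four branch sets
`0, 1, 2, 3`, of which only `0` and `3` are not adjacent along the innermost cycle; `0` and `3` are
joined around the outside of the fifth branch set, a rectangle on top of the four columns. All five
sets meet at least `h` rows. -/
def branchK5 (K h c : ℕ) : Fin 5 → Set (Fin K × Fin (2 * K)) :=
  ![rect K 0 (2 * h + 1) c (c + 1) ∪ rect K 0 h c (c + 2) ∪ rect K (2 * h) (2 * h + 1) c (c + 6),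
    rect K 0 h (c + 2) (c + 3),
    rect K 0 h (c + 3) (c + 4),
    rect K 0 h (c + 4) (c + 6) ∪ rect K 0 (2 * h) (c + 5) (c + 6),
    rect K h (2 * h) (c + 1) (c + 5)]

theorem connected_branchK5 {K h c : ℕ} (hh : 0 < h) (hK : 2 * h + 1 ≤ K) (hc : c + 6 ≤ 2 * K)
    (j : Fin 5) : ((shallowVortexGrid K).induce (branchK5 K h c j)).Connected := by
  fin_cases j
  · refine connected_union (connected_union (connected_rect (by omega) (by omega) (by omega)
      (by omega)) (connected_rect (by omega) (by omega) (by omega) (by omega)) ?_)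
      (connected_rect (by omega) (by omega) (by omega) (by omega)) ?_
    · refine ⟨(⟨0, by omega⟩, ⟨c, by omega⟩), ?_⟩
      simp [rect, hh]
    · refine ⟨(⟨2 * h, by omega⟩, ⟨c, by omega⟩), ?_⟩
      simp [rect]
  · exact connected_rect (by omega) (by omega) (by omega) (by omega)
  · exact connected_rect (by omega) (by omega) (by omega) (by omega)
  · refine connected_union (connected_rect (by omega) (by omega) (by omega) (by omega))
      (connected_rect (by omega) (by omega) (by omega) (by omega)) ?_
    refine ⟨(⟨0, by omega⟩, ⟨c + 5, by omega⟩), ?_⟩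
    simp [rect, hh]
  · exact connected_rect (by omega) (by omega) (by omega) (by omega)

theorem branchK5_subset {K h c : ℕ} {j : Fin 5} {w : Fin K × Fin (2 * K)}
    (hw : w ∈ branchK5 K h c j) : c ≤ (w.2 : ℕ) ∧ (w.2 : ℕ) < c + 6 := by
  fin_cases j <;> simp [branchK5, rect] at hw <;> omega

theorem disjoint_branchK5 {K h c : ℕ} {j j' : Fin 5} {w : Fin K × Fin (2 * K)}
    (hw : w ∈ branchK5 K h c j) (hw' : w ∈ branchK5 K h c j') : j = j' := by
  fin_cases j <;> fin_cases j' <;> first | rfl | (simp [branchK5, rect] at hw hw'; omega)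

theorem adj_branchK5 {K h c : ℕ} (hh : 0 < h) (hK : 2 * h + 1 ≤ K) (hc : c + 6 ≤ 2 * K)
    {j j' : Fin 5} (hj : j ≠ j') : ∃ x ∈ branchK5 K h c j, ∃ y ∈ branchK5 K h c j',
      (shallowVortexGrid K).Adj x y := by
  wlog hlt : j < j' generalizing j j'
  · obtain ⟨x, hx, y, hy, hxy⟩ := this hj.symm (lt_of_le_of_ne (not_lt.1 hlt) hj.symm)
    exact ⟨y, hy, x, hx, hxy.symm⟩
  obtain ⟨p, rfl⟩ : ∃ p, h = p + 1 := ⟨h - 1, by omega⟩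
  have col : ∀ a (_ : a + 1 < 6), (shallowVortexGrid K).Adj (⟨0, by omega⟩, ⟨c + a, by omega⟩)
      (⟨0, by omega⟩, ⟨c + a + 1, by omega⟩) := fun a _ => adj_next_column _ _
  have skip : ∀ a (_ : a + 2 < 6), (shallowVortexGrid K).Adj (⟨0, by omega⟩, ⟨c + a, by omega⟩)
      (⟨0, by omega⟩, ⟨c + a + 2, by omega⟩) := fun a _ => adj_skip_column _ _
  have top : ∀ a (_ : a < 6), (shallowVortexGrid K).Adj (⟨p, by omega⟩, ⟨c + a, by omega⟩)
      (⟨p + 1, by omega⟩, ⟨c + a, by omega⟩) := fun a _ => adj_next_row _ _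
  have outer : (shallowVortexGrid K).Adj (⟨2 * p + 1 + 1, by omega⟩, ⟨c + 5, by omega⟩)
      (⟨2 * p + 1, by omega⟩, ⟨c + 5, by omega⟩) := (adj_next_row _ _).symm
  fin_cases j <;> fin_cases j' <;> first | (exact absurd hlt (by decide)) | skip
  · refine ⟨_, ?_, _, ?_, col 1 (by omega)⟩ <;> simp [branchK5, rect]
  · refine ⟨_, ?_, _, ?_, skip 1 (by omega)⟩ <;> simp [branchK5, rect]
  · refine ⟨_, ?_, (⟨2 * p + 1, by omega⟩, ⟨c + 5, by omega⟩), ?_, outer⟩ <;>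
      simp [branchK5, rect] <;> omega
  · refine ⟨_, ?_, _, ?_, top 1 (by omega)⟩ <;> simp [branchK5, rect]
  · refine ⟨_, ?_, _, ?_, col 2 (by omega)⟩ <;> simp [branchK5, rect]
  · refine ⟨_, ?_, _, ?_, skip 2 (by omega)⟩ <;> simp [branchK5, rect]
  · refine ⟨_, ?_, _, ?_, top 2 (by omega)⟩ <;> simp [branchK5, rect]
  · refine ⟨_, ?_, _, ?_, col 3 (by omega)⟩ <;> simp [branchK5, rect]
  · refine ⟨_, ?_, _, ?_, top 3 (by omega)⟩ <;> simp [branchK5, rect]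
  · refine ⟨_, ?_, _, ?_, top 4 (by omega)⟩ <;> simp [branchK5, rect]

theorem exists_mem_branchK5 {K h c : ℕ} (hK : 2 * h + 1 ≤ K) (hc : c + 6 ≤ 2 * K) (j : Fin 5) :
    ∃ ρ, ρ + h ≤ K ∧ ∀ r (hr : r < K), ρ ≤ r → r < ρ + h →
      ∃ b, (⟨r, hr⟩, b) ∈ branchK5 K h c j := by
  fin_cases j
  · exact ⟨0, by omega, fun r hr _ h2 => ⟨⟨c, by omega⟩, by simp [branchK5, rect]; omega⟩⟩
  · exact ⟨0, by omega, fun r hr _ h2 => ⟨⟨c + 2, by omega⟩, by simp [branchK5, rect]; omega⟩⟩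
  · exact ⟨0, by omega, fun r hr _ h2 => ⟨⟨c + 3, by omega⟩, by simp [branchK5, rect]; omega⟩⟩
  · exact ⟨0, by omega, fun r hr _ h2 => ⟨⟨c + 4, by omega⟩, by simp [branchK5, rect]; omega⟩⟩
  · exact ⟨h, by omega, fun r hr _ h2 => ⟨⟨c + 1, by omega⟩, by simp [branchK5, rect]; omega⟩⟩

/-! ### From the grid to a torso -/

theorem exists_disjoint_of_ncard_lt {V : Type*} [Finite V] {m : ℕ} (F : Fin m → Set V)
    (hF : ∀ i j, i ≠ j → Disjoint (F i) (F j)) {S : Set V} (hS : S.ncard < m) :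
    ∃ i, ∀ v ∈ F i, v ∉ S := by
  by_contra! hcon
  choose v hv hvS using hcon
  have h := Set.ncard_le_ncard_of_injOn v (s := Set.univ) (fun i _ => hvS i) (by
    intro i _ j _ h
    by_contra hne
    exact Set.disjoint_left.1 (hF i j hne) (hv i) (h ▸ hv j)) (Set.toFinite S)
  rw [Set.ncard_univ, Nat.card_fin] at h
  omega

/-- Let the bag of `t` meet the image of every union of a row and a column in a minor model `X` of
the shallow vortex grid. Then it meets the image of every connected set `Y` that has vertices in more
rows than the adhesion sets have elements. Otherwise the image of `Y` lies beyond an adhesion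
set; some row meeting `Y` and some column avoid this adhesion set, so that their images lie
beyond it as well. -/
theorem exists_mem_bag_of_meets_rows {V ι : Type*} [Finite V] {G : SimpleGraph V}
    {T : SimpleGraph ι} (D : TreeDecomposition G T) {K : ℕ}
    {X : Fin K × Fin (2 * K) → Set V} (hconn : ∀ w, (G.induce (X w)).Connected)
    (hdisj : ∀ w w', w ≠ w' → Disjoint (X w) (X w'))
    (hadj : ∀ w w', (shallowVortexGrid K).Adj w w' → ∃ x ∈ X w, ∃ y ∈ X w', G.Adj x y)
    {t : ι} {h : ℕ} (hadh : ∀ d, T.Adj t d → (D.bag t ∩ D.bag d).ncard < h)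
    (hcross : ∀ r < K, ∀ c < 2 * K,
      ∃ w ∈ rect K r (r + 1) 0 (2 * K) ∪ rect K 0 K c (c + 1), ∃ x ∈ X w, x ∈ D.bag t)
    {Y : Set (Fin K × Fin (2 * K))} (hY : ((shallowVortexGrid K).induce Y).Connected) {ρ : ℕ}
    (hρ : ρ + h ≤ K) (hrows : ∀ r (hr : r < K), ρ ≤ r → r < ρ + h → ∃ b, (⟨r, hr⟩, b) ∈ Y) :
    ((⋃ w ∈ Y, X w) ∩ D.bag t).Nonempty := by
  by_contra hcon
  have hav : ∀ x ∈ ⋃ w ∈ Y, X w, x ∉ D.bag t := fun x hx hxt => hcon ⟨x, hx, hxt⟩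
  obtain ⟨d, hd, hside⟩ := D.exists_treeSide_of_disjoint_bag (connected_biUnion hconn hadj hY) hav
  have huniq : ∀ {w w' v}, v ∈ X w → v ∈ X w' → w = w' := by
    intro w w' v h h'
    by_contra hne
    exact Set.disjoint_left.1 (hdisj w w' hne) h h'
  obtain ⟨i, hi⟩ := exists_disjoint_of_ncard_lt
    (fun i : Fin h => ⋃ w ∈ rect K (ρ + i) (ρ + i + 1) 0 (2 * K), X w) (by
      intro i j hij
      refine Set.disjoint_left.2 fun v hv hv' => hij ?_
      obtain ⟨w, hw, hvw⟩ := Set.mem_iUnion₂.1 hv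
      obtain ⟨w', hw', hvw'⟩ := Set.mem_iUnion₂.1 hv'
      obtain rfl := huniq hvw hvw'
      simp only [rect, Set.mem_ofPred_eq] at hw hw'
      exact Fin.ext (by omega)) (hadh d hd)
  have hpos : h ≤ K := by omega
  obtain ⟨c, hc⟩ := exists_disjoint_of_ncard_lt
    (fun c : Fin (2 * K) => ⋃ w ∈ rect K 0 K c (c + 1), X w) (by
      intro i j hij
      refine Set.disjoint_left.2 fun v hv hv' => hij ?_
      obtain ⟨w, hw, hvw⟩ := Set.mem_iUnion₂.1 hv
      obtain ⟨w', hw', hvw'⟩ := Set.mem_iUnion₂.1 hv'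
      obtain rfl := huniq hvw hvw'
      simp only [rect, Set.mem_ofPred_eq] at hw hw'
      exact Fin.ext (by omega)) (S := D.bag t ∩ D.bag d) (by have := hadh d hd; omega)
  have hiK : ρ + i < K := by have := i.2; omega
  obtain ⟨b, hb⟩ := hrows (ρ + i) hiK (by omega) (by omega)
  have hZ : ((shallowVortexGrid K).induce
      (Y ∪ (rect K (ρ + i) (ρ + i + 1) 0 (2 * K) ∪ rect K 0 K c (c + 1)))).Connected := by
    refine connected_union hY (connected_union (connected_rect (by omega) (by omega) (by omega)
      le_rfl) (connected_rect (by omega) le_rfl (by omega) c.2) ?_) ?_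
    · exact ⟨(⟨ρ + i, hiK⟩, c), by simp [rect], by simp [rect]⟩
    · exact ⟨(⟨ρ + i, hiK⟩, b), hb, Or.inl (by simp [rect])⟩
  obtain ⟨x, hx⟩ := (connected_biUnion hconn hadj hY).nonempty
  obtain ⟨s, hs⟩ := D.exists_mem_bag x
  have key := (D.disjoint_bag_of_avoids_adhesion hd (connected_biUnion hconn hadj hZ) (by
    intro v hv hvt hvd
    obtain ⟨w, hw, hvw⟩ := Set.mem_iUnion₂.1 hv
    rcases hw with hw | hw | hw
    · exact hav v (Set.mem_biUnion hw hvw) hvt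
    · exact hi v (Set.mem_biUnion hw hvw) ⟨hvt, hvd⟩
    · exact hc v (Set.mem_biUnion hw hvw) ⟨hvt, hvd⟩)
    (Set.biUnion_subset_biUnion_left Set.subset_union_left hx) (hav x hx) hs (hside x hx s hs)).1
  obtain ⟨w, hw, y, hy, hyt⟩ := hcross (ρ + i) hiK c c.2
  exact key y (Set.mem_biUnion (Or.inr hw) hy) hyt

theorem le_of_isMinor_shallowVortexGrid {V : Type*} [Finite V] {G : SimpleGraph V} {k K : ℕ}
    (hG : HasGenusApexDecomposition G k) (hK : IsMinor (shallowVortexGrid K) G) :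
    K ≤ 20 * k + 10 := by
  by_contra! hcon
  obtain ⟨n, T, D, hD⟩ := hG
  obtain ⟨X, hconn, hdisj, hadj⟩ := hK
  have hmin : ∀ t, ¬ IsMinor (copiesK5 (2 * k + 1)) (D.torso t) := fun t =>
    not_isMinor_copiesK5 (hD t)
  have hadh : ∀ t d, T.Adj t d → (D.bag t ∩ D.bag d).ncard < 10 * k + 5 := fun t d hd => by
    have := D.ncard_adhesion_le hd (hmin t)
    omega
  -- the crosses, unions of a row and a column, intersect pairwise
  let cross : Fin K × Fin (2 * K) → Set (Fin K × Fin (2 * K)) := fun p =>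
    rect K p.1 (p.1 + 1) 0 (2 * K) ∪ rect K 0 K p.2 (p.2 + 1)
  obtain ⟨t, ht⟩ := D.exists_bag_meets_all (fun p => ⋃ w ∈ cross p, X w) (fun p =>
    connected_biUnion hconn hadj (connected_union
      (connected_rect (by omega) p.1.2 (by omega) le_rfl)
      (connected_rect (by omega) le_rfl (by omega) p.2.2) ⟨p, by simp [rect], by simp [rect]⟩)) (by
    intro p q
    obtain ⟨x, hx⟩ := (hconn (p.1, q.2)).nonempty
    exact ⟨x, Set.mem_biUnion (Or.inl (by simp [rect])) hx,
      Set.mem_biUnion (Or.inr (by simp [rect])) hx⟩)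
  have hcross : ∀ r < K, ∀ c < 2 * K,
      ∃ w ∈ rect K r (r + 1) 0 (2 * K) ∪ rect K 0 K c (c + 1), ∃ x ∈ X w, x ∈ D.bag t := by
    intro r hr c hc
    obtain ⟨x, hx, hxt⟩ := ht (⟨r, hr⟩, ⟨c, hc⟩)
    obtain ⟨w, hw, hxw⟩ := Set.mem_iUnion₂.1 hx
    exact ⟨w, hw, x, hxw, hxt⟩
  refine hmin t ?_
  let Y : Fin (2 * k + 1) × Fin 5 → Set (Fin K × Fin (2 * K)) := fun w =>
    branchK5 K (10 * k + 5) (6 * w.1) w.2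
  have hYconn : ∀ w, ((shallowVortexGrid K).induce (Y w)).Connected := fun w =>
    connected_branchK5 (by omega) (by omega) (by omega) _
  have hmeet : ∀ w, ((⋃ v ∈ Y w, X v) ∩ D.bag t).Nonempty := by
    intro w
    obtain ⟨ρ, hρ, hrows⟩ := exists_mem_branchK5 (K := K) (h := 10 * k + 5) (c := 6 * w.1)
      (by omega) (by omega) w.2
    exact exists_mem_bag_of_meets_rows D hconn hdisj hadj (hadh t) hcross (hYconn w) hρ hrows
  have hYdisj : ∀ w w', w ≠ w' → Disjoint (⋃ v ∈ Y w, X v) (⋃ v ∈ Y w', X v) := by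
    intro w w' hne
    refine Set.disjoint_left.2 fun v hv hv' => hne ?_
    obtain ⟨u, hu, hvu⟩ := Set.mem_iUnion₂.1 hv
    obtain ⟨u', hu', hvu'⟩ := Set.mem_iUnion₂.1 hv'
    have huu' : u = u' := by
      by_contra hne
      exact Set.disjoint_left.1 (hdisj u u' hne) hvu hvu'
    subst huu'
    have h1 := branchK5_subset hu
    have h2 := branchK5_subset hu'
    have h3 : w.1 = w'.1 := Fin.ext (by omega)
    obtain ⟨i, j⟩ := w
    obtain ⟨i', j'⟩ := w'
    obtain rfl : i = i' := h3
    exact congrArg (Prod.mk i) (disjoint_branchK5 hu hu')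
  refine ⟨fun w => {v | (v : V) ∈ ⋃ u ∈ Y w, X u}, fun w =>
    D.connected_torso_induce t (connected_biUnion hconn hadj (hYconn w)) (hmeet w),
    fun w w' hne => ?_, fun w w' hww' => ?_⟩
  · exact Set.disjoint_left.2 fun v hv hv' => Set.disjoint_left.1 (hYdisj w w' hne) hv hv'
  · refine D.exists_adj_torso t (connected_biUnion hconn hadj (hYconn w))
      (connected_biUnion hconn hadj (hYconn w')) (hmeet w) (hmeet w') (hYdisj w w' hww'.ne) ?_
    obtain ⟨i, j⟩ := w
    obtain ⟨i', j'⟩ := w'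
    obtain ⟨hi, hj⟩ : i = i' ∧ j ≠ j' := hww'
    subst hi
    obtain ⟨u, hu, u', hu', huu'⟩ := adj_branchK5 (K := K) (h := 10 * k + 5) (c := 6 * i)
      (by omega) (by omega) (by omega) hj
    obtain ⟨x, hx, y, hy, hxy⟩ := hadj u u' huu'
    exact ⟨x, Set.mem_biUnion hu hx, y, Set.mem_biUnion hu' hy, hxy⟩

end VortexGrid

theorem mainTheorem7 :
    ∃ f : ℕ → ℕ, ∀ {V : Type*} [Finite V] (G : SimpleGraph V),
      VortexGrid.vortexParam G ≤ f (VortexGrid.genusApexParam G) :=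
  ⟨fun k => 20 * k + 10, fun G =>
    VortexGrid.le_of_isMinor_shallowVortexGrid (VortexGrid.isLeast_genusApexParam G).1
      (VortexGrid.isGreatest_vortexParam G).1⟩
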